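/- \textbf{Setting.} An \emph{orthogonal terrain} $T$ is an $x$-monotone polygonal chain with $n\ge 2$ vertices $v_1,\dots,v_n\in\mathbb R^2$, indexed from left to right along the chain, whose (nondegenerate) edges $\overline{v_iv_{i+1}}$ are alternately vertical and horizontal, the first and the last edge being vertical. Write $p<q$ ("$p$ is left of $q$") if $p.x<q.x$; "higher" and "lower" compare $y$-coordinates. Two vertices $p,q$ \emph{see} each other if no point of the segment $\overline{pq}$ is strictly below $T$. Walking along $T$ from left to right, a vertex is \emph{left} (\emph{right}) if one walks at it from a vertical (horizontal) edge to a horizontal (vertical) one, and \emph{convex} (\emph{reflex}) if one turns left (right) at it; for $v_1$ and $v_n$ a dummy horizontal edge outside the terrain is added. For a left convex vertex $v$, the right horizon $R(v)$ is the rightmost reflex vertex that sees $v$. \textbf{The sweep.} A stack $\mathcal{MS}$ holds reflex vertices $g$, each with a current obstacle $obs(g)$, a vertex of $T$; the \emph{shadow ray} of $g$ is the ray from $g$ through $obs(g)$. Every vertex $g$ has an associated list $L(g)$. Initially the stack and all lists are empty. The events are the vertices of $T$ and those points strictly above $T$ at which the non-parallel shadow rays of two vertices currently adjacent in $\mathcal{MS}$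 cross, away from the origins of both rays. The rightmost remaining event is handled next, until no vertex is left; of two vertices with the same abscissa the one of larger index comes first, and ties involving an intersection are broken arbitrarily. An event $v$ is handled as follows. 1. \emph{$v$ left convex.} Pop until $\mathcal{MS}$ is empty, or its top sees $v$, or its top is right of $R(v)$. If the top now sees $v$, append $v$ to the list of the top; otherwise push $R(v)$ with $obs(R(v))=v$ and append $v$ to $L(R(v))$. 2. \emph{$v$ right convex.} Do nothing. 3. \emph{$v$ left reflex.} Pop while the top sees $v$; if something was popped, push the last popped vertex back, with obstacle $v$. 4. \emph{$v$ right reflex.} Let $u$ be the top (if any). Pop while the top is lower than $v$. If $u$ is lower than $v$ and $L(u)$ consists of a single vertex $p$, move $p$ from $L(u)$ to $L(v)$ and push $v$, its obstacle being the other endpoint of its horizontal edge (for $v=v_1$ the obstacle is irrelevant). Then delete from $\mathcal{MS}$ all vertices that see $v$ except for the rightmost of them. 5. \emph{$v$ an intersection.} Delete from $\mathcal{MS}$ all vertices whose shadow rays contain $v$ except for the rightmost of them. Let $G=\{g : L(g)\ne\emptyset\}$ be the output when the sweep terminates, and let $F$ be the set of all vertices that are the first element of $L(g)$ (the one put into the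 list first) for some $g\in G$. \textbf{Lemma.} For every orthogonal terrain $T$ as above, every terminating execution of the sweep, and any two distinct vertices $u,v\in F$, there is no reflex vertex of $T$ that sees both $u$ and $v$. -/

import Mathlib

noncomputable section

/-! ### Orthogonal terrains -/

/-- The edge from `p` to `q` is (nondegenerate and) vertical. -/
def IsVerticalEdge (p q : ℝ × ℝ) : Prop := p.1 = q.1 ∧ p.2 ≠ q.2

/-- The edge from `p` to `q` is (nondegenerate and) horizontal. -/
def IsHorizontalEdge (p q : ℝ × ℝ) : Prop := p.2 = q.2 ∧ p.1 ≠ q.1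

/-- A 1.5D orthogonal terrain with `n` vertices: an `x`-monotone polygonal chain whose edges are
horizontal or vertical, without two consecutive edges of the same kind, and which begins and ends
with a vertical edge. The vertices are indexed from left to right along the chain. -/
structure OrthogonalTerrain (n : ℕ) where
  vertex : Fin n → ℝ × ℝ
  two_le : 2 ≤ n
  x_monotone : Monotone fun i => (vertex i).1
  axis_parallel : ∀ i j : Fin n, i.val + 1 = j.val →
    IsVerticalEdge (vertex i) (vertex j) ∨ IsHorizontalEdge (vertex i) (vertex j)
  alternating : ∀ i j k : Fin n, i.val + 1 = j.val → j.val + 1 = k.val →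
    (IsVerticalEdge (vertex i) (vertex j) ↔ IsHorizontalEdge (vertex j) (vertex k))
  first_vertical : ∀ i j : Fin n, i.val + 1 = j.val → i.val = 0 →
    IsVerticalEdge (vertex i) (vertex j)
  last_vertical : ∀ i j : Fin n, i.val + 1 = j.val → j.val + 1 = n →
    IsVerticalEdge (vertex i) (vertex j)

namespace OrthogonalTerrain

variable {n : ℕ} (T : OrthogonalTerrain n)

/-- The abscissa of a vertex. -/
def x (v : Fin n) : ℝ := (T.vertex v).1

/-- The ordinate (height) of a vertex. -/
def y (v : Fin n) : ℝ := (T.vertex v).2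

/-- The set of points of the terrain: the union of its edges. -/
def points : Set (ℝ × ℝ) :=
  {p | ∃ i j : Fin n, i.val + 1 = j.val ∧ p ∈ segment ℝ (T.vertex i) (T.vertex j)}

/-- The point `z` is strictly below the terrain. -/
def StrictlyBelow (z : ℝ × ℝ) : Prop := ∀ t ∈ T.points, t.1 = z.1 → z.2 < t.2

/-- The point `z` is (strictly) above the terrain. -/
def StrictlyAbove (z : ℝ × ℝ) : Prop := ∀ t ∈ T.points, t.1 = z.1 → t.2 < z.2

/-- Two vertices see each other if the segment between them is never strictly below the terrain. -/
def Sees (p q : Fin n) : Prop :=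
  ∀ z ∈ segment ℝ (T.vertex p) (T.vertex q), ¬ T.StrictlyBelow z

/-! Walking along the terrain from left to right, every horizontal edge (also a dummy one at either
end of the terrain) is walked rightwards. So at a left vertex, which is entered along a vertical
edge, one turns left (convex) after walking down and right (reflex) after walking up; at a right
vertex, which is left along a vertical edge, one turns left (convex) to walk up and right (reflex)
to walk down. -/

/-- Left convex vertices. -/
def LeftConvex (v : Fin n) : Prop := ∃ u : Fin n, u.val + 1 = v.val ∧ T.x u = T.x v ∧ T.y v < T.y u

/-- Left reflex vertices. -/
def LeftReflex (v : Fin n) : Prop := ∃ u : Fin n, u.val + 1 = v.val ∧ T.x u = T.x v ∧ T.y u < T.y v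

/-- Right convex vertices. -/
def RightConvex (v : Fin n) : Prop :=
  ∃ w : Fin n, v.val + 1 = w.val ∧ T.x v = T.x w ∧ T.y v < T.y w

/-- Right reflex vertices. -/
def RightReflex (v : Fin n) : Prop :=
  ∃ w : Fin n, v.val + 1 = w.val ∧ T.x v = T.x w ∧ T.y w < T.y v

/-- Reflex vertices. -/
def Reflex (v : Fin n) : Prop := T.LeftReflex v ∨ T.RightReflex v

/-- `r` is the right horizon of `v`: the rightmost reflex vertex that can see `v`. -/
def IsRightHorizon (v r : Fin n) : Prop :=
  T.Reflex r ∧ T.Sees r v ∧ ∀ r' : Fin n, T.Reflex r' → T.Sees r' v → T.x r' ≤ T.x r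

end OrthogonalTerrain

/-! ### The state of the sweep -/

/-- An element of the stack: a guard together with its current obstacle. Its shadow ray is the ray
from the guard through the obstacle. -/
structure StackEntry (n : ℕ) where
  guard : Fin n
  obs : Fin n

/-- A state of the sweep: the vertices of index `< unswept` are those still in the event queue,
`stack` is the modified stack (its head is the top), and `list g` is the list associated with `g`,
in the order in which the vertices were put into it. -/
structure SweepState (n : ℕ) where
  unswept : ℕ
  stack : List (StackEntry n)
  list : Fin n → List (Fin n)

/-- Initially no vertex is swept and the stack and all the lists are empty. -/
def SweepState.initial (n : ℕ) : SweepState n := ⟨n, [], fun _ => []⟩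

/-- Append `v` to the list of `g`. -/
def appendTo {n : ℕ} (L : Fin n → List (Fin n)) (g v : Fin n) : Fin n → List (Fin n) :=
  Function.update L g (L g ++ [v])

namespace OrthogonalTerrain

variable {n : ℕ} (T : OrthogonalTerrain n)

/-- The direction of the shadow ray of a stack entry. -/
def rayDir (e : StackEntry n) : ℝ × ℝ := T.vertex e.obs - T.vertex e.guard

/-- The point with parameter `t` on the shadow ray of a stack entry. -/
def rayPoint (e : StackEntry n) (t : ℝ) : ℝ × ℝ := T.vertex e.guard + t • T.rayDir e

/-- The shadow ray of `e` is incident in `z`. -/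
def RayIncident (e : StackEntry n) (z : ℝ × ℝ) : Prop := ∃ t : ℝ, 0 ≤ t ∧ z = T.rayPoint e t

/-- The shadow rays of `e` and `f`, which are not parallel, intersect in `z`, and `z` is the origin
of neither. -/
def InteriorIntersection (e f : StackEntry n) (z : ℝ × ℝ) : Prop :=
  (T.rayDir e).1 * (T.rayDir f).2 ≠ (T.rayDir e).2 * (T.rayDir f).1 ∧
    (∃ t : ℝ, 0 < t ∧ z = T.rayPoint e t) ∧ (∃ t : ℝ, 0 < t ∧ z = T.rayPoint f t)

/-- `z` is a pending intersection event: an interior intersection of the shadow rays of two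
entries adjacent in the stack that lies above the terrain. (An intersection that is not above the
terrain has no effect when it is handled, so it is not listed as an event. Handling one that is
above the terrain deletes at least one of the two entries.) -/
def Pending (st : List (StackEntry n)) (z : ℝ × ℝ) : Prop :=
  ∃ e f : StackEntry n, [e, f] <:+: st ∧ T.InteriorIntersection e f z ∧ T.StrictlyAbove z

/-- `v` can be the next event: it is the last vertex of the queue, and no pending intersection is
to the right of it. -/
def NextVertex (s : SweepState n) (v : Fin n) : Prop :=
  s.unswept = v.val + 1 ∧ ∀ z, T.Pending s.stack z → z.1 ≤ T.x v

/-- The intersection `z` can be the next event: a vertex is left in the queue, and neither the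
vertices left nor the other pending intersections are to the right of `z`. -/
def NextIntersection (s : SweepState n) (z : ℝ × ℝ) : Prop :=
  T.Pending s.stack z ∧ (∀ z', T.Pending s.stack z' → z'.1 ≤ z.1) ∧
    ∃ v : Fin n, s.unswept = v.val + 1 ∧ T.x v ≤ z.1

open scoped Classical in
/-- Handling a left convex vertex `v` with right horizon `r`: pop until the top sees `v` or is to
the right of `r` (or the stack is empty). If the top sees `v`, add `v` to its list. Otherwise push
`r` with the dummy shadow ray from `r` to `v`, and add `v` to the list of `r`. -/
def handleLeftConvex (v r : Fin n) (s : SweepState n) : SweepState n :=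
  let st := s.stack.dropWhile fun e => decide (¬ (T.Sees e.guard v ∨ T.x r < T.x e.guard))
  let pushed : SweepState n := ⟨v.val, ⟨r, v⟩ :: st, appendTo s.list r v⟩
  match st with
  | [] => pushed
  | e :: _ => if T.Sees e.guard v then ⟨v.val, st, appendTo s.list e.guard v⟩ else pushed

/-- Handling a right convex vertex: nothing to be done. -/
def handleRightConvex (v : Fin n) (s : SweepState n) : SweepState n := ⟨v.val, s.stack, s.list⟩

open scoped Classical in
/-- Handling a left reflex vertex `v`: pop until the top does not see `v`, then push back the last
popped entry (if any) with `v` as its obstacle. -/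
def handleLeftReflex (v : Fin n) (s : SweepState n) : SweepState n :=
  let popped := s.stack.takeWhile fun e => decide (T.Sees e.guard v)
  let rest := s.stack.dropWhile fun e => decide (T.Sees e.guard v)
  match popped.getLast? with
  | none => ⟨v.val, s.stack, s.list⟩
  | some e => ⟨v.val, ⟨e.guard, v⟩ :: rest, s.list⟩

open scoped Classical in
/-- From a stack, delete all entries with the property `P` except for the rightmost one. -/
def deleteExceptRightmost (st : List (StackEntry n)) (P : StackEntry n → Prop) :
    List (StackEntry n) :=
  st.filter fun e => decide (¬ (P e ∧ ∃ f ∈ st, P f ∧ T.x e.guard < T.x f.guard))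

/-- The vertex preceding `v` on the terrain (for a right vertex `v`: the other endpoint of its
horizontal edge); the first vertex, after which nothing is swept, is its own predecessor. -/
def pred (v : Fin n) : Fin n := ⟨v.val - 1, lt_of_le_of_lt (Nat.sub_le _ _) v.isLt⟩

open scoped Classical in
/-- The first step in handling a right reflex vertex `v`: pop while the top is lower than `v`. If
the former top `u` is lower than `v` and there is only one vertex `p` in its list, move `p` from
the list of `u` to the list of `v` and push `v`, with the vertex sharing its horizontal edge as
obstacle. -/
def popLower (v : Fin n) (s : SweepState n) : SweepState n :=
  let st := s.stack.dropWhile fun e => decide (T.y e.guard < T.y v)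
  match s.stack with
  | [] => ⟨v.val, st, s.list⟩
  | u :: _ =>
    match s.list u.guard with
    | [p] =>
      if T.y u.guard < T.y v then
        ⟨v.val, ⟨v, pred v⟩ :: st, appendTo (Function.update s.list u.guard []) v p⟩
      else ⟨v.val, st, s.list⟩
    | _ => ⟨v.val, st, s.list⟩

/-- Handling a right reflex vertex `v`: the first step, and then all entries that see `v` are
deleted except for the rightmost one. -/
def handleRightReflex (v : Fin n) (s : SweepState n) : SweepState n :=
  let s' := T.popLower v s
  ⟨v.val, T.deleteExceptRightmost s'.stack fun e => T.Sees e.guard v, s'.list⟩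

/-- Handling an intersection `z` above the terrain: all entries whose shadow rays are incident in
`z` are deleted except for the rightmost one. -/
def handleIntersection (z : ℝ × ℝ) (s : SweepState n) : SweepState n :=
  ⟨s.unswept, T.deleteExceptRightmost s.stack fun e => T.RayIncident e z, s.list⟩

/-- One iteration of the sweep, from right to left, which handles the rightmost event. Of two
vertices with the same abscissa, the one of larger index comes first; ties that involve an
intersection may be broken arbitrarily. -/
inductive Step : SweepState n → SweepState n → Prop
  | leftConvex (s : SweepState n) (v r : Fin n) : T.NextVertex s v → T.LeftConvex v →
      T.IsRightHorizon v r → Step s (T.handleLeftConvex v r s)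
  | rightConvex (s : SweepState n) (v : Fin n) : T.NextVertex s v → T.RightConvex v →
      Step s (handleRightConvex v s)
  | leftReflex (s : SweepState n) (v : Fin n) : T.NextVertex s v → T.LeftReflex v →
      Step s (T.handleLeftReflex v s)
  | rightReflex (s : SweepState n) (v : Fin n) : T.NextVertex s v → T.RightReflex v →
      Step s (T.handleRightReflex v s)
  | intersection (s : SweepState n) (z : ℝ × ℝ) : T.NextIntersection s z →
      Step s (T.handleIntersection z s)

/-- `L` is the family of associated lists when the sweep terminates, that is, when no vertex is
left in the event queue. -/
def IsFinalLists (L : Fin n → List (Fin n)) : Prop :=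
  ∃ st : List (StackEntry n), Relation.ReflTransGen T.Step (SweepState.initial n) ⟨0, st, L⟩

end OrthogonalTerrain

/-- The output of the sweep: the vertices with nonempty associated lists. -/
def outputSet {n : ℕ} (L : Fin n → List (Fin n)) : Set (Fin n) := {g | L g ≠ []}

/-- The set of the first vertices in the lists of the output vertices. -/
def firstSet {n : ℕ} (L : Fin n → List (Fin n)) : Set (Fin n) :=
  {v | ∃ g ∈ outputSet L, (L g).head? = some v}

end

noncomputable section
namespace OrthogonalTerrain

variable {n : ℕ} (T : OrthogonalTerrain n)

/-! ### Parity of the indices -/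

/-! The proof rests on an invariant of the sweep (`SweepInv`): if a reflex vertex `w` sees an
unswept left convex vertex `v` and also some `f` that is already first in a list, then some guard on
the stack sees `v` (`Covered`), apart from one short-lived exception (`Transient`). A left convex
vertex becomes first in a list only when no guard on the stack sees it, so by the invariant it
shares no reflex witness with an earlier first vertex (`independent_handleLeftConvex`). Moving an
element in the right reflex event creates no new first vertex (`firstSet_move`).

Coverage survives because a removed guard is either useless or replaced. The tool is the order claim
(`Clear.cross`): if `g` sees `v`, `g'` sees `b`, and `v`, `b`, `g`, `g'` lie in this order from left
to right, then `g'` sees `v`. With the current vertex as `b` it transfers coverage to a guard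
further right at left convex, left reflex and right reflex events. With the intersection point of
two rays as `b` it does so at intersections (`sees_of_rayIncident`). Guards popped for being lower
than a right reflex vertex see nothing to the left of it.

The order claim is useful at a left reflex event only if the guards that see the vertex form the top
segment of the stack. This is what shadow rays and intersection events ensure: if, of two adjacent
guards, only the one nearer the bottom saw the vertex, then their rays would cross strictly above
the terrain further right, at an event that should already have been handled (`sees_of_adjacent`).
`EntryInv` and `PairInv` record the required positions of guards, obstacles and rays.

The exception arises when the right horizon `r` is pushed for `f` and the witness `w` is the vertex
right above `f`. If `r` is lower than `w`, it need not see what `w` sees on the left. But `w` is the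
next vertex and replaces `r`, taking over its one-element list; until then no intersection event can
delete `r` (`not_rayIncident`). -/

theorem vertical_iff_even {i j : Fin n} (h : i.val + 1 = j.val) :
    IsVerticalEdge (T.vertex i) (T.vertex j) ↔ Even i.val := by
  obtain ⟨i, hi⟩ := i
  obtain ⟨j, hj⟩ := j
  simp only at h
  subst h
  induction i with
  | zero => simpa using T.first_vertical ⟨0, hi⟩ ⟨0 + 1, hj⟩ rfl rfl
  | succ i ih =>
    have h1 := ih (by omega) hi
    have h2 := T.alternating ⟨i, by omega⟩ ⟨i + 1, hi⟩ ⟨i + 1 + 1, hj⟩ rfl rfl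
    have h3 := T.axis_parallel ⟨i + 1, hi⟩ ⟨i + 1 + 1, hj⟩ rfl
    have h4 : IsVerticalEdge (T.vertex ⟨i + 1, hi⟩) (T.vertex ⟨i + 1 + 1, hj⟩) →
        ¬ IsHorizontalEdge (T.vertex ⟨i + 1, hi⟩) (T.vertex ⟨i + 1 + 1, hj⟩) :=
      fun a b => b.2 a.1
    rw [Nat.even_add_one, ← h1, h2]
    tauto

theorem even_card (T : OrthogonalTerrain n) : Even n := by
  have h2 := T.two_le
  have h := T.last_vertical ⟨n - 2, by omega⟩ ⟨n - 1, by omega⟩ (by simp; omega) (by simp; omega)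
  rw [T.vertical_iff_even (by simp; omega)] at h
  obtain ⟨m, hm⟩ := h
  exact ⟨m + 1, by simp only at hm; omega⟩

theorem vertical_step {i j : Fin n} (h : i.val + 1 = j.val) (hi : Even i.val) :
    T.x i = T.x j ∧ T.y i ≠ T.y j :=
  (T.vertical_iff_even h).2 hi

theorem x_mono {i j : Fin n} (h : i ≤ j) : T.x i ≤ T.x j := T.x_monotone h

theorem horizontal_step {i j : Fin n} (h : i.val + 1 = j.val) (hi : Odd i.val) :
    T.y i = T.y j ∧ T.x i < T.x j := by
  have h1 := (T.axis_parallel i j h).resolve_left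
    (by rw [T.vertical_iff_even h]; exact Nat.not_even_iff_odd.2 hi)
  exact ⟨h1.1, lt_of_le_of_ne (T.x_mono (by rw [Fin.le_def]; omega)) h1.2⟩

theorem even_of_x_eq {i j : Fin n} (h : i.val + 1 = j.val) (hx : T.x i = T.x j) :
    Even i.val := by
  by_contra h'
  exact absurd hx (T.horizontal_step h (Nat.not_even_iff_odd.1 h')).2.ne

theorem x_lt_of_odd {i j : Fin n} (h : i < j) (hi : Odd i.val) : T.x i < T.x j := by
  rw [Fin.lt_def] at h
  have h1 := T.horizontal_step (i := i) (j := ⟨i.val + 1, by omega⟩) rfl hi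
  exact h1.2.trans_le (T.x_mono (by rw [Fin.le_def]; simp only; omega))

theorem lt_of_x_lt {i j : Fin n} (h : T.x i < T.x j) : i < j := by
  by_contra h'
  exact absurd (T.x_mono (not_lt.1 h')) (not_le.2 h)

theorem eq_of_x_eq {i j : Fin n} (h : T.x i = T.x j) (hp : Odd i.val ↔ Odd j.val) : i = j := by
  have key : ∀ {i j : Fin n}, T.x i = T.x j → (Odd i.val ↔ Odd j.val) → ¬ i < j := by
    intro i j h hp hij
    by_cases hi : Odd i.val
    · exact absurd h (T.x_lt_of_odd hij hi).ne
    · have h1 : i.val + 1 < j.val := by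
        rw [Fin.lt_def] at hij
        rcases Nat.lt_or_ge (i.val + 1) j.val with h | h
        · exact h
        · have : j.val = i.val + 1 := by omega
          rw [Nat.not_odd_iff_even] at hi
          rw [this] at hp
          exact absurd (hp.2 hi.add_one) (Nat.not_odd_iff_even.2 hi)
      have h2 := T.x_lt_of_odd (i := ⟨i.val + 1, by omega⟩) (j := j) h1
        (by simp only; exact (Nat.not_odd_iff_even.1 hi).add_one)
      have h3 := T.x_mono (i := i) (j := ⟨i.val + 1, by omega⟩) (by rw [Fin.le_def]; simp)
      linarith
  rcases lt_trichotomy i j with h' | h' | h'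
  · exact absurd h' (key h hp)
  · exact h'
  · exact absurd h' (key h.symm hp.symm)

theorem LeftConvex.odd {T : OrthogonalTerrain n} {v : Fin n} (h : T.LeftConvex v) :
    Odd v.val := by
  obtain ⟨u, hu, hx, -⟩ := h
  rw [← hu]
  exact (T.even_of_x_eq hu hx).add_one

theorem LeftReflex.odd {T : OrthogonalTerrain n} {v : Fin n} (h : T.LeftReflex v) :
    Odd v.val := by
  obtain ⟨u, hu, hx, -⟩ := h
  rw [← hu]
  exact (T.even_of_x_eq hu hx).add_one

theorem RightConvex.even {T : OrthogonalTerrain n} {v : Fin n} (h : T.RightConvex v) :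
    Even v.val := by
  obtain ⟨w, hw, hx, -⟩ := h
  exact T.even_of_x_eq hw hx

theorem RightReflex.even {T : OrthogonalTerrain n} {v : Fin n} (h : T.RightReflex v) :
    Even v.val := by
  obtain ⟨w, hw, hx, -⟩ := h
  exact T.even_of_x_eq hw hx

theorem leftConvex_or_leftReflex {v : Fin n} (h : Odd v.val) :
    T.LeftConvex v ∨ T.LeftReflex v := by
  have h0 : 0 < v.val := h.pos
  have h1 : (⟨v.val - 1, by omega⟩ : Fin n).val + 1 = v.val := by simp only; omega
  have h2 := T.vertical_step h1 (by
    obtain ⟨m, hm⟩ := h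
    exact ⟨m, by simp only; omega⟩)
  rcases lt_or_gt_of_ne h2.2 with h3 | h3
  · exact Or.inr ⟨_, h1, h2.1, h3⟩
  · exact Or.inl ⟨_, h1, h2.1, h3⟩

theorem LeftConvex.not_leftReflex {T : OrthogonalTerrain n} {v : Fin n} (h : T.LeftConvex v) :
    ¬ T.LeftReflex v := by
  rintro ⟨u, hu, -, hy⟩
  obtain ⟨u', hu', -, hy'⟩ := h
  have : u = u' := Fin.ext (by omega)
  subst this
  exact lt_asymm hy hy'

theorem LeftConvex.not_reflex {T : OrthogonalTerrain n} {v : Fin n} (h : T.LeftConvex v) :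
    ¬ T.Reflex v := by
  rintro (h' | h')
  · exact h.not_leftReflex h'
  · exact Nat.not_even_iff_odd.2 h.odd h'.even

theorem RightConvex.not_reflex {T : OrthogonalTerrain n} {v : Fin n} (h : T.RightConvex v) :
    ¬ T.Reflex v := by
  rintro (h' | ⟨w, hw, -, hy⟩)
  · exact Nat.not_even_iff_odd.2 h'.odd h.even
  · obtain ⟨w', hw', -, hy'⟩ := h
    have : w = w' := Fin.ext (by omega)
    subst this
    exact lt_asymm hy hy'

/-- Two vertices of the same abscissa are the ends of one vertical edge, and only the upper end is
reflex. Hence guards may be compared by abscissa alone. -/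
theorem Reflex.eq_of_x_eq {T : OrthogonalTerrain n} {v w : Fin n} (hv : T.Reflex v)
    (hw : T.Reflex w) (h : T.x v = T.x w) : v = w := by
  have key : ∀ {v w : Fin n}, T.LeftReflex v → T.RightReflex w → T.x v ≠ T.x w := by
    rintro v w hv ⟨w', hw', hx, hy⟩ h
    have h1 : v = w' := T.eq_of_x_eq (h.trans hx) (by
      simp [hv.odd, ← hw', (RightReflex.even ⟨w', hw', hx, hy⟩).add_one])
    subst h1
    exact LeftConvex.not_leftReflex ⟨w, hw', hx, hy⟩ hv
  rcases hv with hv | hv <;> rcases hw with hw | hw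
  · exact T.eq_of_x_eq h (by simp [hv.odd, hw.odd])
  · exact absurd h (key hv hw)
  · exact absurd h.symm (key hw hv)
  · exact T.eq_of_x_eq h (by
      simp [← Nat.not_even_iff_odd, hv.even, hw.even])

/-! ### Segments that are nowhere strictly below the terrain -/

/-- No point of the segment between `P` and `Q` is strictly below the terrain. -/
def Clear (P Q : ℝ × ℝ) : Prop := ∀ z ∈ segment ℝ P Q, ¬ T.StrictlyBelow z

theorem Clear.symm {T : OrthogonalTerrain n} {P Q : ℝ × ℝ} (h : T.Clear P Q) : T.Clear Q P := by
  intro z hz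
  rw [segment_symm] at hz
  exact h z hz

theorem Sees.symm {T : OrthogonalTerrain n} {v w : Fin n} (h : T.Sees v w) : T.Sees w v :=
  Clear.symm h

variable {T} in
theorem StrictlyBelow.mono {u z : ℝ × ℝ} (h : T.StrictlyBelow z) (h1 : u.1 = z.1)
    (h2 : u.2 ≤ z.2) : T.StrictlyBelow u :=
  fun t ht e => h2.trans_lt (h t ht (e.trans h1))

theorem exists_slope {P Q : ℝ × ℝ} (h : P.1 < Q.1) : ∃ m : ℝ, Q.2 = P.2 + m * (Q.1 - P.1) :=
  ⟨(Q.2 - P.2) / (Q.1 - P.1), by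
    rw [div_mul_cancel₀ _ (sub_pos.2 h).ne']; ring⟩

theorem mem_segment_iff_slope {P Q z : ℝ × ℝ} {m : ℝ} (h : P.1 < Q.1)
    (hm : Q.2 = P.2 + m * (Q.1 - P.1)) :
    z ∈ segment ℝ P Q ↔ P.1 ≤ z.1 ∧ z.1 ≤ Q.1 ∧ z.2 = P.2 + m * (z.1 - P.1) := by
  have h' := sub_pos.2 h
  constructor
  · rintro ⟨a, b, ha, hb, hab, rfl⟩
    obtain rfl : a = 1 - b := by linarith
    simp only [Prod.fst_add, Prod.smul_fst, smul_eq_mul, Prod.snd_add, Prod.smul_snd]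
    refine ⟨by nlinarith, by nlinarith, ?_⟩
    rw [hm]; ring
  · rintro ⟨h1, h2, h3⟩
    refine ⟨(Q.1 - z.1) / (Q.1 - P.1), (z.1 - P.1) / (Q.1 - P.1),
      div_nonneg (by linarith) h'.le, div_nonneg (by linarith) h'.le, ?_, ?_⟩
    · rw [← add_div, div_eq_one_iff_eq h'.ne']; ring
    · have h4 := h'.ne'
      ext
      · simp only [Prod.fst_add, Prod.smul_fst, smul_eq_mul]
        field_simp
        ring
      · simp only [Prod.snd_add, Prod.smul_snd, smul_eq_mul]
        rw [hm, h3]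
        field_simp
        ring

theorem clear_iff_slope {P Q : ℝ × ℝ} {m : ℝ} (h : P.1 < Q.1)
    (hm : Q.2 = P.2 + m * (Q.1 - P.1)) :
    T.Clear P Q ↔ ∀ a, P.1 ≤ a → a ≤ Q.1 → ¬ T.StrictlyBelow (a, P.2 + m * (a - P.1)) := by
  constructor
  · intro H a h1 h2
    exact H _ ((mem_segment_iff_slope h hm).2 ⟨h1, h2, rfl⟩)
  · intro H z hz
    obtain ⟨h1, h2, h3⟩ := (mem_segment_iff_slope h hm).1 hz
    have := H z.1 h1 h2
    rwa [← h3] at this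

/-- `a` lies on or below the line through `P` and `Q`, where `P` is to the left of `Q`. -/
def OnOrBelow (P Q a : ℝ × ℝ) : Prop := (a.2 - P.2) * (Q.1 - P.1) ≤ (Q.2 - P.2) * (a.1 - P.1)

theorem onOrBelow_iff_slope {P Q a : ℝ × ℝ} {m : ℝ} (h : P.1 < Q.1)
    (hm : Q.2 = P.2 + m * (Q.1 - P.1)) : OnOrBelow P Q a ↔ a.2 ≤ P.2 + m * (a.1 - P.1) := by
  have h' := sub_pos.2 h
  unfold OnOrBelow
  rw [hm, show (P.2 + m * (Q.1 - P.1) - P.2) * (a.1 - P.1) = m * (a.1 - P.1) * (Q.1 - P.1) by ring,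
    mul_le_mul_iff_left₀ h']
  constructor <;> intro <;> linarith

/-- The order claim: if `v` sees `g` and `b` sees `g'`, in the order `v`, `b`, `g`, `g'`, then `v`
sees `g'`. -/
theorem Clear.cross {T : OrthogonalTerrain n} {v b g g' : ℝ × ℝ} (hvb : v.1 ≤ b.1)
    (hbg : b.1 < g.1) (hgg : g.1 < g'.1) (h1 : T.Clear v g) (h2 : T.Clear b g')
    (hb : OnOrBelow v g b) (hg : OnOrBelow b g' g) : T.Clear v g' := by
  obtain ⟨m₁, hm₁⟩ := exists_slope (hvb.trans_lt hbg)
  obtain ⟨m₂, hm₂⟩ := exists_slope (hbg.trans hgg)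
  obtain ⟨m₃, hm₃⟩ := exists_slope ((hvb.trans_lt hbg).trans hgg)
  rw [onOrBelow_iff_slope (hvb.trans_lt hbg) hm₁] at hb
  rw [onOrBelow_iff_slope (hbg.trans hgg) hm₂] at hg
  rw [T.clear_iff_slope (hvb.trans_lt hbg) hm₁] at h1
  rw [T.clear_iff_slope (hbg.trans hgg) hm₂] at h2
  rw [T.clear_iff_slope ((hvb.trans_lt hbg).trans hgg) hm₃]
  -- The slopes of `vg`, `vg'` and `bg'` are increasing in this order, so `vg'` runs above `vg` up
  -- to `g` and above `bg'` from there on.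
  have e1 : m₁ ≤ m₂ := by
    by_contra h
    push Not at h
    nlinarith
  have e3 : m₁ ≤ m₃ := by
    have : 0 ≤ (m₂ - m₁) * (g'.1 - g.1) := mul_nonneg (by linarith) (by linarith)
    by_contra h
    push Not at h
    nlinarith [mul_pos (sub_pos.2 h) (sub_pos.2 ((hvb.trans_lt hbg).trans hgg))]
  have e4 : m₃ ≤ m₂ := by
    by_contra h
    push Not at h
    have : 0 ≤ (m₂ - m₁) * (b.1 - v.1) := mul_nonneg (by linarith) (by linarith)
    nlinarith [mul_pos (sub_pos.2 h) (sub_pos.2 ((hvb.trans_lt hbg).trans hgg))]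
  intro a ha1 ha2
  rcases le_total a g.1 with h | h
  · refine fun hS => h1 a ha1 h (hS.mono rfl ?_)
    simp only
    nlinarith
  · refine fun hS => h2 a (hbg.le.trans h) ha2 (hS.mono rfl ?_)
    simp only
    nlinarith

/-- Since `w` is not above `vg`, the slope of `vg` lies between those of `vw` and `wg`, so `vg` runs
above the broken line through `w`. -/
theorem Clear.concat {T : OrthogonalTerrain n} {v w g : ℝ × ℝ} (hvw : v.1 < w.1)
    (hwg : w.1 < g.1) (h1 : T.Clear v w) (h2 : T.Clear w g) (hw : OnOrBelow v g w) :
    T.Clear v g := by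
  obtain ⟨m₁, hm₁⟩ := exists_slope hvw
  obtain ⟨m₂, hm₂⟩ := exists_slope hwg
  obtain ⟨m₃, hm₃⟩ := exists_slope (hvw.trans hwg)
  rw [onOrBelow_iff_slope (hvw.trans hwg) hm₃] at hw
  rw [T.clear_iff_slope hvw hm₁] at h1
  rw [T.clear_iff_slope hwg hm₂] at h2
  rw [T.clear_iff_slope (hvw.trans hwg) hm₃]
  have e1 : m₁ ≤ m₃ := by
    by_contra h
    push Not at h
    nlinarith
  have e2 : m₃ ≤ m₂ := by
    by_contra h
    push Not at h
    nlinarith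
  intro a ha1 ha2
  rcases le_total a w.1 with h | h
  · refine fun hS => h1 a ha1 h (hS.mono rfl ?_)
    simp only
    nlinarith
  · refine fun hS => h2 a h ha2 (hS.mono rfl ?_)
    simp only
    nlinarith

/-- Raising the left endpoint of a segment. -/
theorem Clear.raise {T : OrthogonalTerrain n} {P P' Q : ℝ × ℝ} (hPQ : P.1 < Q.1)
    (h1 : P'.1 = P.1) (h2 : P.2 ≤ P'.2) (h : T.Clear P Q) : T.Clear P' Q := by
  obtain ⟨m, hm⟩ := exists_slope hPQ
  obtain ⟨m', hm'⟩ := exists_slope (P := P') (Q := Q) (by rwa [h1])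
  rw [T.clear_iff_slope hPQ hm] at h
  rw [T.clear_iff_slope (by rwa [h1]) hm', h1]
  rw [h1] at hm'
  have e : m' ≤ m := by
    by_contra h
    push Not at h
    nlinarith
  intro a ha1 ha2
  refine fun hS => h a ha1 ha2 (hS.mono rfl ?_)
  simp only
  nlinarith

/-! ### Horizontal edges under clear segments, and heights of vertices that see each other -/

theorem eq_y_of_mem_points {i j : Fin n} (h : i.val + 1 = j.val) (hi : Odd i.val) {t : ℝ × ℝ}
    (ht : t ∈ T.points) (h1 : T.x i < t.1) (h2 : t.1 < T.x j) : t.2 = T.y i := by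
  obtain ⟨a, b, hab, a', b', ha', hb', hs, rfl⟩ := ht
  simp only [Prod.fst_add, Prod.smul_fst, smul_eq_mul] at h1 h2
  change T.x i < a' * T.x a + b' * T.x b at h1
  change a' * T.x a + b' * T.x b < T.x j at h2
  have hx : T.x a ≤ T.x b := T.x_mono (by rw [Fin.le_def]; omega)
  obtain rfl : a' = 1 - b' := by linarith
  rcases lt_trichotomy a i with h' | rfl | h'
  · have : T.x b ≤ T.x i := T.x_mono (by rw [Fin.lt_def] at h'; rw [Fin.le_def]; omega)
    nlinarith
  · obtain rfl : b = j := Fin.ext (by omega)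
    have hy := (T.horizontal_step h hi).1
    change (1 - b') * T.y a + b' * T.y b = T.y a
    rw [← hy]; ring
  · have : T.x j ≤ T.x a := T.x_mono (by rw [Fin.lt_def] at h'; rw [Fin.le_def]; omega)
    nlinarith

theorem vertex_mem_points (v : Fin n) : T.vertex v ∈ T.points := by
  have := T.two_le
  rcases Nat.lt_or_ge (v.val + 1) n with h | h
  · exact ⟨v, ⟨v.val + 1, h⟩, rfl, left_mem_segment _ _ _⟩
  · exact ⟨⟨v.val - 1, by omega⟩, v, by simp only; omega, right_mem_segment _ _ _⟩

theorem not_strictlyBelow_vertex (v : Fin n) : ¬ T.StrictlyBelow (T.vertex v) :=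
  fun h => lt_irrefl _ (h _ (T.vertex_mem_points v) rfl)

theorem edge_mem_points {i j : Fin n} (h : i.val + 1 = j.val) (hi : Odd i.val) {a : ℝ}
    (h1 : T.x i ≤ a) (h2 : a ≤ T.x j) : (a, T.y i) ∈ T.points := by
  have h3 := T.horizontal_step h hi
  refine ⟨i, j, h, ?_⟩
  rw [mem_segment_iff_slope (m := 0) h3.2 (by
    change T.y j = T.y i + _
    rw [h3.1]; ring)]
  refine ⟨h1, h2, ?_⟩
  change T.y i = T.y i + _
  ring

theorem exists_edge {p g : Fin n} {a : ℝ} (h1 : T.x p ≤ a) (h2 : a < T.x g) :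
    ∃ i j : Fin n, i.val + 1 = j.val ∧ Odd i.val ∧ T.x i ≤ a ∧ a < T.x j := by
  classical
  have hne : (Finset.univ.filter fun i => T.x i ≤ a).Nonempty := ⟨p, by simpa using h1⟩
  obtain ⟨i, hi, hmax⟩ := Finset.exists_max_image _ id hne
  simp only [Finset.mem_filter, Finset.mem_univ, true_and, id] at hi hmax
  have h3 : i < g := T.lt_of_x_lt (hi.trans_lt h2)
  rw [Fin.lt_def] at h3
  have h4 : a < T.x ⟨i.val + 1, by omega⟩ := by
    by_contra h
    have := hmax _ (not_lt.1 h)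
    rw [Fin.le_def] at this
    simp at this
  refine ⟨i, _, rfl, ?_, hi, h4⟩
  by_contra h
  have h5 := (T.vertical_step (i := i) (j := ⟨i.val + 1, by omega⟩) rfl
    (Nat.not_odd_iff_even.1 h)).1
  linarith

variable {T}

/-- Over the interior of a horizontal edge the terrain consists of that edge only. At its ends,
being not strictly below says less, because a vertical edge there may reach further down; the bound
at the ends is obtained as a limit. -/
theorem Clear.edge_le {P Q : ℝ × ℝ} (h : T.Clear P Q) (hPQ : P.1 < Q.1) {m : ℝ}
    (hm : Q.2 = P.2 + m * (Q.1 - P.1)) {i j : Fin n} (hij : i.val + 1 = j.val) (hi : Odd i.val)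
    (h1 : T.x i < Q.1) (h2 : P.1 < T.x j) {a : ℝ} (ha1 : T.x i ≤ a) (ha2 : a ≤ T.x j)
    (ha3 : P.1 ≤ a) (ha4 : a ≤ Q.1) : T.y i ≤ P.2 + m * (a - P.1) := by
  have hlt := (T.horizontal_step hij hi).2
  have key : Set.Ioo (max (T.x i) P.1) (min (T.x j) Q.1) ⊆ {a | T.y i ≤ P.2 + m * (a - P.1)} := by
    rintro a ⟨h3, h4⟩
    rw [max_lt_iff] at h3
    rw [lt_min_iff] at h4
    by_contra h5
    rw [Set.mem_ofPred_eq, not_le] at h5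
    refine (T.clear_iff_slope hPQ hm).1 h a h3.2.le h4.2.le fun t ht e => ?_
    simp only at e
    rw [T.eq_y_of_mem_points hij hi ht (by rw [e]; exact h3.1) (by rw [e]; exact h4.1)]
    exact h5
  have hcl : IsClosed {a : ℝ | T.y i ≤ P.2 + m * (a - P.1)} :=
    isClosed_le continuous_const (by fun_prop)
  have h6 := hcl.closure_subset_iff.2 key
  rw [closure_Ioo (max_lt (lt_min hlt h1) (lt_min h2 hPQ)).ne] at h6
  exact h6 ⟨max_le ha1 ha3, le_min ha2 ha4⟩

/-- A vertex strictly between the endpoints of a clear segment is not above the segment. -/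
theorem Clear.onOrBelow {P : ℝ × ℝ} {p g a : Fin n} (h : T.Clear P (T.vertex g))
    (hp : T.x p ≤ P.1) (h1 : P.1 < T.x a) (h2 : T.x a < T.x g) :
    OnOrBelow P (T.vertex g) (T.vertex a) := by
  have hPQ : P.1 < (T.vertex g).1 := h1.trans h2
  obtain ⟨m, hm⟩ := exists_slope hPQ
  rw [onOrBelow_iff_slope hPQ hm]
  by_cases ha : Odd a.val
  · have h3 : a < g := T.lt_of_x_lt h2
    rw [Fin.lt_def] at h3
    have h4 := T.horizontal_step (i := a) (j := ⟨a.val + 1, by omega⟩) rfl ha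
    exact h.edge_le hPQ hm (i := a) (j := ⟨a.val + 1, by omega⟩) rfl ha h2 (h1.trans h4.2) le_rfl
      h4.2.le h1.le h2.le
  · have h3 : p < a := T.lt_of_x_lt (hp.trans_lt h1)
    rw [Fin.lt_def] at h3
    have hj : (⟨a.val - 1, by omega⟩ : Fin n).val + 1 = a.val := by simp only; omega
    have ho : Odd (⟨a.val - 1, by omega⟩ : Fin n).val := by
      rw [Nat.not_odd_iff_even, ← hj, Nat.even_add_one, Nat.not_even_iff_odd] at ha
      exact ha
    have h4 := T.horizontal_step hj ho
    change T.y a ≤ _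
    rw [← h4.1]
    exact h.edge_le hPQ hm hj ho (h4.2.trans h2) h1 h4.2.le le_rfl h1.le h2.le

theorem Sees.onOrBelow {v a g : Fin n} (h : T.Sees v g) (h1 : T.x v < T.x a)
    (h2 : T.x a < T.x g) : OnOrBelow (T.vertex v) (T.vertex g) (T.vertex a) :=
  Clear.onOrBelow h (p := v) le_rfl h1 h2

/-- A vertex of odd index is the left end of a horizontal edge, and a clear segment leaving it to
the right cannot descend below that edge. -/
theorem Sees.y_le_of_odd {v g : Fin n} (h : T.Sees v g) (hx : T.x v < T.x g)
    (hv : Odd v.val) : T.y v ≤ T.y g := by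
  have hPQ : (T.vertex v).1 < (T.vertex g).1 := hx
  obtain ⟨m, hm⟩ := exists_slope hPQ
  have h3 : v < g := T.lt_of_x_lt hx
  rw [Fin.lt_def] at h3
  have hlt := (T.horizontal_step (i := v) (j := ⟨v.val + 1, by omega⟩) rfl hv).2
  have hle : T.x ⟨v.val + 1, by omega⟩ ≤ T.x g := T.x_mono (by rw [Fin.le_def]; simp only; omega)
  have h4 := Clear.edge_le h hPQ hm (i := v) (j := ⟨v.val + 1, by omega⟩) rfl hv hx hlt hlt.le
    le_rfl hlt.le hle
  have h5 : 0 ≤ m := by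
    change T.y v ≤ T.y v + m * (T.x _ - T.x v) at h4
    by_contra h
    push Not at h
    nlinarith
  change T.y g = T.y v + m * (T.x g - T.x v) at hm
  nlinarith

theorem Sees.y_le_of_even {v g : Fin n} (h : T.Sees v g) (hx : T.x v < T.x g)
    (hg : Even g.val) : T.y g ≤ T.y v := by
  have hPQ : (T.vertex v).1 < (T.vertex g).1 := hx
  obtain ⟨m, hm⟩ := exists_slope hPQ
  have h3 : v < g := T.lt_of_x_lt hx
  rw [Fin.lt_def] at h3
  have hj : (⟨g.val - 1, by omega⟩ : Fin n).val + 1 = g.val := by simp only; omega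
  have ho : Odd (⟨g.val - 1, by omega⟩ : Fin n).val := by
    rw [← hj, Nat.even_add_one, Nat.not_even_iff_odd] at hg
    exact hg
  have hs := T.horizontal_step hj ho
  have hle : T.x v ≤ T.x ⟨g.val - 1, by omega⟩ := T.x_mono (by rw [Fin.le_def]; simp only; omega)
  have h4 := Clear.edge_le h hPQ hm hj ho hs.2 hx le_rfl hs.2.le hle hs.2.le
  rw [hs.1] at h4
  change T.y g = T.y v + m * (T.x g - T.x v) at hm
  change T.y g ≤ T.y v + m * (T.x _ - T.x v) at h4
  have h5 : m ≤ 0 := by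
    by_contra h
    push Not at h
    nlinarith
  nlinarith

/-- The wall above a left convex vertex blocks every view from the left: the segment would have to
pass over the edge that ends at the top of the wall. -/
theorem LeftConvex.x_le_of_sees {v g : Fin n} (hv : T.LeftConvex v) (h : T.Sees g v) :
    T.x v ≤ T.x g := by
  by_contra hx
  push Not at hx
  obtain ⟨u, hu, hux, huy⟩ := hv
  have hPQ : (T.vertex g).1 < (T.vertex v).1 := hx
  obtain ⟨m, hm⟩ := exists_slope hPQ
  have he := T.even_of_x_eq hu hux
  have h3 : g < u := T.lt_of_x_lt (by rwa [hux])
  rw [Fin.lt_def] at h3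
  have hj : (⟨u.val - 1, by omega⟩ : Fin n).val + 1 = u.val := by simp only; omega
  have ho : Odd (⟨u.val - 1, by omega⟩ : Fin n).val := by
    rw [← hj, Nat.even_add_one, Nat.not_even_iff_odd] at he
    exact he
  have hs := T.horizontal_step hj ho
  have h4 := Clear.edge_le h hPQ hm hj ho (by rw [hux] at hs; exact hs.2) (by rwa [hux])
    (a := T.x v) (by rw [← hux]; exact hs.2.le) hux.ge hx.le le_rfl
  rw [hs.1] at h4
  exact absurd (h4.trans hm.ge) (not_le.2 huy)

/-- Every vertex from a left reflex vertex on is dominated by a left reflex vertex that is not to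
its right. -/
theorem exists_leftReflex_ge {b : Fin n} (hb : T.LeftReflex b) (c : Fin n) (hc : b ≤ c) :
    ∃ l : Fin n, T.LeftReflex l ∧ b ≤ l ∧ l ≤ c ∧ T.y c ≤ T.y l := by
  obtain ⟨c, hcn⟩ := c
  induction c with
  | zero =>
    obtain rfl : b = ⟨0, hcn⟩ := le_antisymm hc (Nat.zero_le _)
    exact ⟨_, hb, le_rfl, le_rfl, le_rfl⟩
  | succ c ih =>
    rcases hc.eq_or_lt with rfl | hlt
    · exact ⟨_, hb, le_rfl, le_rfl, le_rfl⟩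
    obtain ⟨l, h1, h2, h3, h4⟩ := ih (by omega) (Nat.le_of_lt_succ hlt)
    have h5 : (⟨c, by omega⟩ : Fin n) ≤ ⟨c + 1, hcn⟩ := Nat.le_succ c
    by_cases ho : Odd (c + 1)
    · rcases T.leftConvex_or_leftReflex (v := ⟨c + 1, hcn⟩) ho with ⟨u, hu, -, huy⟩ | h
      · have hcn' : c < n := by omega
        obtain rfl : u = ⟨c, hcn'⟩ := Fin.ext (by simpa using hu)
        exact ⟨l, h1, h2, h3.trans h5, huy.le.trans h4⟩
      · exact ⟨_, h, hc, le_rfl, le_rfl⟩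
    · have hc' : Odd c := by
        rw [Nat.not_odd_iff_even, Nat.even_add_one, Nat.not_even_iff_odd] at ho
        exact ho
      have h6 := T.horizontal_step (i := ⟨c, by omega⟩) (j := ⟨c + 1, hcn⟩) rfl hc'
      exact ⟨l, h1, h2, h3.trans h5, h6.1.ge.trans h4⟩

/-- A criterion for the visibility of a vertex `g` from a point `P` that is not higher: only left
reflex vertices have to be considered. -/
theorem clear_of_leftReflex {P : ℝ × ℝ} {p g : Fin n} (hp : T.x p ≤ P.1) (hg : P.1 < T.x g)
    (hy : P.2 ≤ T.y g)
    (hP : ∀ i j : Fin n, i.val + 1 = j.val → Odd i.val → T.x i ≤ P.1 → P.1 < T.x j → T.y i ≤ P.2)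
    (hl : ∀ l, T.LeftReflex l → P.1 < T.x l → T.x l < T.x g →
      OnOrBelow P (T.vertex g) (T.vertex l)) :
    T.Clear P (T.vertex g) := by
  have hPQ : P.1 < (T.vertex g).1 := hg
  obtain ⟨m, hm⟩ := exists_slope hPQ
  have hm0 : 0 ≤ m := by
    by_contra h
    change T.y g = P.2 + m * (T.x g - P.1) at hm
    push Not at h
    nlinarith
  have key : ∀ (l : ℕ) (h : l < n), P.1 < T.x ⟨l, h⟩ → T.x ⟨l, h⟩ < T.x g →
      T.y ⟨l, h⟩ ≤ P.2 + m * (T.x ⟨l, h⟩ - P.1) := by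
    intro l
    induction l with
    | zero =>
      intro h h1 h2
      have : T.x ⟨0, h⟩ ≤ T.x p := T.x_mono (Nat.zero_le _)
      linarith
    | succ c ih =>
      intro h h1 h2
      -- Along a line of nonnegative slope the left end of a horizontal edge is the critical one,
      -- and a left convex vertex is below its predecessor. So the bound propagates from left to
      -- right except at left reflex vertices, where it is assumed.
      by_cases ho : Odd (c + 1)
      · rcases T.leftConvex_or_leftReflex (v := ⟨c + 1, h⟩) ho with ⟨u, hu, hux, huy⟩ | h'
        · have hcn : c < n := by omega
          obtain rfl : u = ⟨c, hcn⟩ := Fin.ext (by simpa using hu)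
          have := ih (by omega) (by rwa [hux]) (by rwa [hux])
          rw [hux] at this
          exact huy.le.trans this
        · exact (onOrBelow_iff_slope hPQ hm).1 (hl _ h' h1 h2)
      · have hc' : Odd c := by
          rw [Nat.not_odd_iff_even, Nat.even_add_one, Nat.not_even_iff_odd] at ho
          exact ho
        have h6 := T.horizontal_step (i := ⟨c, by omega⟩) (j := ⟨c + 1, h⟩) rfl hc'
        rw [← h6.1]
        rcases le_or_gt (T.x ⟨c, by omega⟩) P.1 with h7 | h7
        · have := hP _ _ (by simp) hc' h7 h1
          nlinarith
        · have := ih (by omega) h7 (h6.2.trans h2)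
          nlinarith
  rw [T.clear_iff_slope hPQ hm]
  intro a h1 h2
  rcases h2.eq_or_lt with rfl | h2
  · rw [← hm]
    exact T.not_strictlyBelow_vertex g
  obtain ⟨i, j, hij, hi, h3, h4⟩ := T.exists_edge (hp.trans h1) h2
  refine fun hS => absurd (hS _ (T.edge_mem_points hij hi h3 h4.le) rfl) (not_lt.2 ?_)
  simp only
  rcases le_or_gt (T.x i) P.1 with h5 | h5
  · have := hP i j hij hi h5 (h1.trans_lt h4)
    nlinarith
  · have := key i.val i.isLt h5 (h3.trans_lt h2)
    simp only [Fin.eta] at this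
    nlinarith

/-! ### Shadow rays and the stack invariant -/

variable (T)

/-- Positive if `P` is strictly below the line of the shadow ray of `e`, negative if it is strictly
above. -/
def depth (e : StackEntry n) (P : ℝ × ℝ) : ℝ :=
  (T.x e.obs - T.x e.guard) * (P.2 - T.y e.guard) - (T.y e.obs - T.y e.guard) * (P.1 - T.x e.guard)

/-- The properties of a stack entry when the vertices of index `< k` are still to be swept. -/
structure EntryInv (k : ℕ) (e : StackEntry n) : Prop where
  reflex : T.Reflex e.guard
  -- The second alternative is the guard pushed for the last vertex of the terrain when that is left
  -- convex: the guard is right above it and not yet swept.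
  le_guard : k ≤ e.guard.val ∨ e.guard.val + 1 = k ∧ k + 1 = n
  sees : T.Sees e.guard e.obs
  odd_obs : Odd e.obs.val
  y_obs : T.y e.obs ≤ T.y e.guard
  -- A vertical ray occurs only for that same guard, at the right end of the terrain.
  x_obs : T.x e.obs < T.x e.guard ∨
    T.x e.obs = T.x e.guard ∧ T.y e.obs < T.y e.guard ∧ ∀ a, T.x a ≤ T.x e.guard
  high : ∀ a : Fin n, k ≤ a.val → T.x a < T.x e.guard → T.y a ≤ T.y e.guard
  under : ∀ c : Fin n, T.LeftReflex c → k ≤ c.val → T.x c < T.x e.obs →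
    0 < T.depth e (T.vertex c)
  -- An unswept obstacle belongs to a right reflex guard pushed at its own event; its ray runs along
  -- its horizontal edge.
  obs_lt : e.obs.val < k → e.obs.val + 1 = e.guard.val ∧ T.RightReflex e.guard

/-- The relation between two stack entries of which `e` is nearer to the top. -/
structure PairInv (k : ℕ) (e f : StackEntry n) : Prop where
  x_lt : T.x e.guard < T.x f.guard
  y_le : T.y e.guard ≤ T.y f.guard
  depth_guard : 0 ≤ T.depth f (T.vertex e.guard)
  -- The excluded obstacle is a left convex one at the far end of the guard's own horizontal edge,
  -- about which nothing is checked when it is swept. This is harmless: as far as the obstacle the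
  -- ray lies on the terrain, and once the higher vertex above the obstacle is swept, `high` rules
  -- the case out.
  depth_obs : k ≤ e.obs.val → ¬ (T.LeftConvex e.obs ∧ e.obs.val + 1 = e.guard.val) →
    0 < T.depth f (T.vertex e.obs)

structure StackInv (k : ℕ) (st : List (StackEntry n)) : Prop where
  entry : ∀ e ∈ st, T.EntryInv k e
  pair : st.Pairwise (T.PairInv k)

/-! ### Shadow rays decide visibility -/

variable {T}

theorem depth_vertex (e : StackEntry n) (a : Fin n) : T.depth e (T.vertex a) =
    (T.x e.obs - T.x e.guard) * (T.y a - T.y e.guard) -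
      (T.y e.obs - T.y e.guard) * (T.x a - T.x e.guard) := rfl

theorem depth_eq_of_slope {e : StackEntry n} {m : ℝ}
    (hm : T.y e.obs = T.y e.guard + m * (T.x e.obs - T.x e.guard)) (P : ℝ × ℝ) :
    T.depth e P =
      (T.x e.guard - T.x e.obs) * (T.y e.guard + m * (P.1 - T.x e.guard) - P.2) := by
  unfold depth
  rw [hm]; ring

theorem Reflex.y_le {g a : Fin n} (hg : T.Reflex g) (h : T.x a = T.x g) : T.y a ≤ T.y g := by
  rcases hg with hg | hg
  · have ho := hg.odd
    obtain ⟨u, hu, hux, huy⟩ := hg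
    by_cases ha : Odd a.val
    · rw [T.eq_of_x_eq h (by tauto)]
    · rw [T.eq_of_x_eq (h.trans hux.symm) (iff_of_false ha
        (Nat.not_odd_iff_even.2 (T.even_of_x_eq hu hux)))]
      exact huy.le
  · have he := hg.even
    obtain ⟨w, hw, hwx, hwy⟩ := hg
    by_cases ha : Odd a.val
    · rw [T.eq_of_x_eq (h.trans hwx) (iff_of_true ha (by rw [← hw]; exact he.add_one))]
      exact hwy.le
    · rw [T.eq_of_x_eq h (iff_of_false ha (Nat.not_odd_iff_even.2 he))]

theorem EntryInv.y_le {k : ℕ} {e : StackEntry n} (he : T.EntryInv k e) {a : Fin n}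
    (ha : k ≤ a.val) (hx : T.x a ≤ T.x e.guard) : T.y a ≤ T.y e.guard := by
  rcases hx.eq_or_lt with h | h
  · exact he.reflex.y_le h
  · exact he.high a ha h

/-- To the left of the obstacle this is `under`; between obstacle and guard it holds because these
two see each other. -/
theorem EntryInv.depth_nonneg {k : ℕ} {e : StackEntry n} (he : T.EntryInv k e) {c : Fin n}
    (hc : T.LeftReflex c) (hk : k ≤ c.val) (hx : T.x c < T.x e.guard) :
    0 ≤ T.depth e (T.vertex c) := by
  rcases lt_trichotomy (T.x c) (T.x e.obs) with h | h | h
  · exact (he.under c hc hk h).le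
  · obtain rfl := T.eq_of_x_eq h (iff_of_true hc.odd he.odd_obs)
    rw [depth_vertex, mul_comm, sub_self]
  · have h1 := he.sees.symm.onOrBelow h hx
    change (T.y c - T.y e.obs) * (T.x e.guard - T.x e.obs) ≤
      (T.y e.guard - T.y e.obs) * (T.x c - T.x e.obs) at h1
    rw [depth_vertex]
    linarith

/-- The obstacle is not above the segment from `v` to the guard, so `v` is not below the ray.
Conversely, `sees_of_depth` derives visibility from this position. -/
theorem EntryInv.depth_nonpos {k : ℕ} {e : StackEntry n} (he : T.EntryInv k e) {v : Fin n}
    (hv : T.Sees v e.guard) (hx : T.x v < T.x e.obs) : T.depth e (T.vertex v) ≤ 0 := by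
  rw [depth_vertex]
  rcases he.x_obs with h | ⟨h, hy, -⟩
  · have h1 := hv.onOrBelow hx h
    change (T.y e.obs - T.y v) * (T.x e.guard - T.x v) ≤
      (T.y e.guard - T.y v) * (T.x e.obs - T.x v) at h1
    linarith
  · rw [h] at hx ⊢
    nlinarith

/-- A point that is not strictly below the shadow ray is visible. -/
theorem EntryInv.clear {k : ℕ} {e : StackEntry n} (he : T.EntryInv k e) {P : ℝ × ℝ} {p : Fin n}
    (hp : T.x p ≤ P.1) (hx : P.1 < T.x e.guard) (hy : P.2 ≤ T.y e.guard)
    (hP : ∀ i j : Fin n, i.val + 1 = j.val → Odd i.val → T.x i ≤ P.1 → P.1 < T.x j → T.y i ≤ P.2)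
    (hk : ∀ l : Fin n, P.1 < T.x l → k ≤ l.val) (hd : T.depth e P ≤ 0) :
    T.Clear P (T.vertex e.guard) := by
  refine clear_of_leftReflex hp hx hy hP fun l hl h1 h2 => ?_
  have h3 := he.depth_nonneg hl (hk l h1) h2
  rcases he.x_obs with h | ⟨h, hyo, -⟩
  · obtain ⟨m, hm⟩ : ∃ m : ℝ, T.y e.obs = T.y e.guard + m * (T.x e.obs - T.x e.guard) :=
      ⟨(T.y e.obs - T.y e.guard) / (T.x e.obs - T.x e.guard), by
        rw [div_mul_cancel₀ _ (sub_neg.2 h).ne]; ring⟩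
    rw [depth_eq_of_slope hm] at h3 hd
    have h4 := nonneg_of_mul_nonneg_right h3 (sub_pos.2 h)
    have h5 := nonpos_of_mul_nonpos_right hd (sub_pos.2 h)
    change T.y e.guard + m * (T.x l - T.x e.guard) - T.y l ≥ 0 at h4
    change (T.y l - P.2) * (T.x e.guard - P.1) ≤ (T.y e.guard - P.2) * (T.x l - P.1)
    nlinarith
  -- For a vertical ray `depth` is negative everywhere to the left, so `under` says that there is no
  -- such `l`.
  · have h4 := he.under l hl (hk l h1) (by rwa [h])
    rw [depth_vertex, h] at h4
    nlinarith

/-- Provides the local hypothesis of `clear_of_leftReflex` at a vertex: the edge just to its right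
starts at the vertex itself or, for a right reflex one, at the vertex below it. -/
theorem edge_right_le {a : Fin n} (ha : Odd a.val ∨ T.RightReflex a) {i j : Fin n}
    (hij : i.val + 1 = j.val) (h1 : T.x i ≤ T.x a) (h2 : T.x a < T.x j) : T.y i ≤ T.y a := by
  have key : ∀ {a : Fin n}, Odd a.val → T.x i ≤ T.x a → T.x a < T.x j → i = a := by
    intro a ha h1 h2
    rcases lt_trichotomy a i with h | h | h
    · exact absurd (T.x_lt_of_odd h ha) (not_lt.2 h1)
    · exact h.symm
    · have : T.x j ≤ T.x a := T.x_mono (by rw [Fin.lt_def] at h; rw [Fin.le_def]; omega)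
      linarith
  rcases ha with ha | ha
  · rw [key ha h1 h2]
  · have he := ha.even
    obtain ⟨w, hw, hx, hy⟩ := ha
    rw [hx] at h1 h2
    rw [key (by rw [← hw]; exact he.add_one) h1 h2]
    exact hy.le

theorem EntryInv.sees_of_depth {k : ℕ} {e : StackEntry n} (he : T.EntryInv k e) {a : Fin n}
    (ha : Odd a.val ∨ T.RightReflex a) (hk : k ≤ a.val + 1) (hx : T.x a < T.x e.guard)
    (hy : T.y a ≤ T.y e.guard) (hd : T.depth e (T.vertex a) ≤ 0) : T.Sees e.guard a := by
  refine Sees.symm (he.clear (p := a) le_rfl hx hy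
    (fun i j hij _ h1 h2 => edge_right_le ha hij h1 h2) (fun l hl => ?_) hd)
  have := T.lt_of_x_lt (i := a) hl
  rw [Fin.lt_def] at this
  omega

theorem EntryInv.le_guard_of_odd {k : ℕ} {e : StackEntry n} (he : T.EntryInv k e) {b : Fin n}
    (hb : Odd b.val) (hk : k = b.val + 1) : k ≤ e.guard.val := by
  rcases he.le_guard with h | ⟨h1, h2⟩
  · exact h
  -- Here `k = n - 1` is odd because `n` is even, whereas `k = b + 1` is even.
  · exfalso
    have h3 := T.even_card
    rw [← h2, hk, Nat.even_add_one, Nat.not_even_iff_odd, ← Nat.not_even_iff_odd,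
      Nat.even_add_one, not_not] at h3
    exact Nat.not_even_iff_odd.2 hb h3

theorem EntryInv.x_lt_of_odd {k : ℕ} {e : StackEntry n} (he : T.EntryInv k e) {b : Fin n}
    (hb : Odd b.val) (hk : k = b.val + 1) : T.x b < T.x e.guard :=
  T.x_lt_of_odd (by have := he.le_guard_of_odd hb hk; rw [Fin.lt_def]; omega) hb

theorem EntryInv.y_le_of_odd {k : ℕ} {e : StackEntry n} (he : T.EntryInv k e) {b : Fin n}
    (hb : Odd b.val) (hk : k = b.val + 1) : T.y b ≤ T.y e.guard := by
  have h1 := he.le_guard_of_odd hb hk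
  have h2 := T.horizontal_step (i := b) (j := ⟨b.val + 1, by omega⟩) rfl hb
  rw [h2.1]
  exact he.y_le hk.le (T.x_mono (by rw [Fin.le_def]; simp only; omega))

theorem EntryInv.depth_pos_of_not_sees {k : ℕ} {e : StackEntry n} (he : T.EntryInv k e)
    {b : Fin n} (hb : Odd b.val) (hk : k = b.val + 1) (hs : ¬ T.Sees e.guard b) :
    0 < T.depth e (T.vertex b) := by
  by_contra h
  exact hs (he.sees_of_depth (Or.inl hb) hk.le (he.x_lt_of_odd hb hk) (he.y_le_of_odd hb hk)
    (not_lt.1 h))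

theorem exists_vertex_ge {b : Fin n} {t : ℝ × ℝ} (ht : t ∈ T.points) (hb : T.x b < t.1) :
    ∃ c : Fin n, b ≤ c ∧ T.x c ≤ t.1 ∧ t.2 ≤ T.y c := by
  obtain ⟨i, j, hij, a', b', ha', hb', hs, rfl⟩ := ht
  obtain rfl : a' = 1 - b' := by linarith
  simp only [Prod.fst_add, Prod.smul_fst, smul_eq_mul, Prod.snd_add, Prod.smul_snd] at hb ⊢
  change T.x b < (1 - b') * T.x i + b' * T.x j at hb
  change ∃ c : Fin n, b ≤ c ∧ T.x c ≤ (1 - b') * T.x i + b' * T.x j ∧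
    (1 - b') * T.y i + b' * T.y j ≤ T.y c
  have hx : T.x i ≤ T.x j := T.x_mono (by rw [Fin.le_def]; omega)
  have hbj : b < j := T.lt_of_x_lt (by nlinarith)
  have hbi : b ≤ i := by rw [Fin.lt_def] at hbj; rw [Fin.le_def]; omega
  by_cases hi : Odd i.val
  · have h := T.horizontal_step hij hi
    exact ⟨i, hbi, by nlinarith, by rw [← h.1]; linarith⟩
  · have h := T.vertical_step hij (Nat.not_odd_iff_even.1 hi)
    rcases le_total (T.y i) (T.y j) with h1 | h1
    · exact ⟨j, hbj.le, by rw [h.1]; linarith, by nlinarith⟩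
    · exact ⟨i, hbi, by rw [h.1]; linarith, by nlinarith⟩

theorem EntryInv.exists_slope {k : ℕ} {e : StackEntry n} (he : T.EntryInv k e)
    (hx : T.x e.obs < T.x e.guard) :
    ∃ m : ℝ, 0 ≤ m ∧ T.y e.obs = T.y e.guard + m * (T.x e.obs - T.x e.guard) := by
  refine ⟨(T.y e.obs - T.y e.guard) / (T.x e.obs - T.x e.guard),
    div_nonneg_of_nonpos (sub_nonpos.2 he.y_obs) (sub_neg.2 hx).le, ?_⟩
  rw [div_mul_cancel₀ _ (sub_neg.2 hx).ne]; ring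

/-- When a left reflex vertex `b` is the next event and the lower one of two adjacent stack entries
sees `b`, then so does the other one: otherwise there is a pending intersection to the right. -/
theorem sees_of_adjacent {k : ℕ} {st : List (StackEntry n)} {e f : StackEntry n}
    (he : T.EntryInv k e) (hf : T.EntryInv k f) (hp : T.PairInv k e f) {b : Fin n}
    (hb : T.LeftReflex b) (hk : k = b.val + 1) (hadj : [e, f] <:+: st)
    (hnext : ∀ z, T.Pending st z → z.1 ≤ T.x b) (hs : T.Sees f.guard b) : T.Sees e.guard b := by
  by_contra hne
  have hbe := he.depth_pos_of_not_sees hb.odd hk hne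
  have hge := he.le_guard_of_odd hb.odd hk
  have hgef := T.lt_of_x_lt hp.x_lt
  rw [Fin.lt_def] at hgef
  have hbf : T.depth f (T.vertex b) ≤ 0 := by
    refine hf.depth_nonpos hs.symm (T.x_lt_of_odd ?_ hb.odd)
    by_contra h
    rw [Fin.lt_def] at h
    have := hf.obs_lt (by omega)
    omega
  -- An unswept obstacle would be adjacent to the guard, hence equal to `b`, which the guard would
  -- then see.
  have hko : k ≤ e.obs.val := by
    by_contra h
    have h1 := (he.obs_lt (by omega)).1
    have h2 : e.obs = b := Fin.ext (by omega)
    exact hne (h2 ▸ he.sees)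
  have hd : 0 < T.depth f (T.vertex e.obs) := by
    refine hp.depth_obs hko ?_
    -- The vertex `u` above such an obstacle is already swept and higher than the guard, against
    -- `high`.
    rintro ⟨⟨u, hu, hux, huy⟩, ho⟩
    have h1 := T.horizontal_step ho he.odd_obs
    have h2 : u.val ≠ b.val := fun h => by
      have := T.even_of_x_eq hu hux
      rw [h] at this
      exact Nat.not_even_iff_odd.2 hb.odd this
    have h3 := he.high u (by omega) (by rw [hux]; exact h1.2)
    linarith [h1.1]
  have hxe : T.x e.obs < T.x e.guard := by
    rcases he.x_obs with h | ⟨-, -, h⟩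
    · exact h
    · exact absurd (h f.guard) (not_le.2 hp.x_lt)
  have hxf : T.x f.obs < T.x f.guard := by
    rcases hf.x_obs with h | ⟨h, hy, -⟩
    · exact h
    · rw [depth_vertex, h] at hd
      nlinarith [hp.x_lt]
  have hbo : T.x b < T.x e.obs := T.x_lt_of_odd (by rw [Fin.lt_def]; omega) hb.odd
  obtain ⟨m, hm0, hm⟩ := he.exists_slope hxe
  obtain ⟨m', hm0', hm'⟩ := hf.exists_slope hxf
  rw [depth_eq_of_slope hm] at hbe
  rw [depth_eq_of_slope hm'] at hbf hd
  have h1 : T.y b < T.y e.guard + m * (T.x b - T.x e.guard) :=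
    sub_pos.1 (pos_of_mul_pos_right hbe (sub_pos.2 hxe).le)
  have h2 : T.y f.guard + m' * (T.x b - T.x f.guard) ≤ T.y b :=
    sub_nonpos.1 (nonpos_of_mul_nonpos_right hbf (sub_pos.2 hxf))
  have h3 : T.y e.obs < T.y f.guard + m' * (T.x e.obs - T.x f.guard) :=
    sub_pos.1 (pos_of_mul_pos_right hd (sub_pos.2 hxf).le)
  -- At `b` the line of `e` is above that of `f`; at the obstacle of `e` it is below. So the rays
  -- cross strictly between these abscissas, at `X`.
  have hmm : m < m' := by
    by_contra h
    push Not at h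
    nlinarith
  have hmm' := sub_pos.2 hmm
  set D := T.y e.guard + m * (T.x b - T.x e.guard) - (T.y f.guard + m' * (T.x b - T.x f.guard))
    with hD
  have hDpos : 0 < D := by linarith
  set X := T.x b + D / (m' - m) with hX
  have hXD : (m' - m) * (X - T.x b) = D := by
    rw [hX]; field_simp; ring
  have hbX : T.x b < X := by
    rw [hX]; linarith [div_pos hDpos hmm']
  have hXo : X < T.x e.obs := by
    by_contra h
    push Not at h
    nlinarith
  have hY : T.y e.guard + m * (X - T.x e.guard) = T.y f.guard + m' * (X - T.x f.guard) := by
    nlinarith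
  have key : ∀ (g : StackEntry n) (m : ℝ), T.x g.obs < T.x g.guard →
      T.y g.obs = T.y g.guard + m * (T.x g.obs - T.x g.guard) → X < T.x g.guard →
      ∃ t : ℝ, 0 < t ∧ (X, T.y g.guard + m * (X - T.x g.guard)) = T.rayPoint g t := by
    intro g m hx hm hX
    have hne := (sub_neg.2 hx).ne
    refine ⟨(X - T.x g.guard) / (T.x g.obs - T.x g.guard),
      div_pos_of_neg_of_neg (sub_neg.2 hX) (sub_neg.2 hx), ?_⟩
    refine Prod.ext ?_ ?_
    · change X = T.x g.guard + _ * (T.x g.obs - T.x g.guard)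
      rw [div_mul_cancel₀ _ hne]; ring
    · change T.y g.guard + m * (X - T.x g.guard) = T.y g.guard + _ * (T.y g.obs - T.y g.guard)
      rw [hm]
      field_simp
      ring
  have hpend : T.Pending st (X, T.y e.guard + m * (X - T.x e.guard)) := by
    refine ⟨e, f, hadj, ⟨?_, key e m hxe hm (hXo.trans hxe), ?_⟩, ?_⟩
    · change (T.x e.obs - T.x e.guard) * (T.y f.obs - T.y f.guard) ≠
        (T.y e.obs - T.y e.guard) * (T.x f.obs - T.x f.guard)
      rw [hm, hm', ← sub_ne_zero]
      have := mul_ne_zero (mul_ne_zero (sub_neg.2 hxe).ne (sub_neg.2 hxf).ne) hmm'.ne'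
      intro h
      apply this
      rw [← h]; ring
    · rw [hY]
      exact key f m' hxf hm' (hXo.trans (hxe.trans hp.x_lt))
    · intro t ht htx
      simp only at htx ⊢
      -- The terrain at `X` is no higher than some left reflex vertex `l` between `b` and `X`. That
      -- vertex is strictly below the ray of `e`, which does not descend from there to `X`.
      obtain ⟨c, hbc, hcx, hcy⟩ := exists_vertex_ge ht (htx ▸ hbX)
      obtain ⟨l, hl, hbl, hlc, hly⟩ := exists_leftReflex_ge hb c hbc
      have hlx : T.x l ≤ X := (T.x_mono hlc).trans (hcx.trans htx.le)
      have hld : 0 < T.depth e (T.vertex l) := by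
        rcases hbl.eq_or_lt with rfl | h
        · rw [depth_eq_of_slope hm]; exact hbe
        · rw [Fin.lt_def] at h
          exact he.under l hl (by omega) (hlx.trans_lt hXo)
      rw [depth_eq_of_slope hm] at hld
      have h4 : T.y l < T.y e.guard + m * (T.x l - T.x e.guard) :=
        sub_pos.1 (pos_of_mul_pos_right hld (sub_pos.2 hxe).le)
      nlinarith
  exact absurd (hnext _ hpend) (not_le.2 hbX)

/-! ### Updating the stack invariant -/

theorem StackInv.sublist {k : ℕ} {st st' : List (StackEntry n)} (h : T.StackInv k st)
    (hs : st'.Sublist st) : T.StackInv k st' :=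
  ⟨fun e he => h.entry e (hs.subset he), h.pair.sublist hs⟩

/-- The next vertex `q` is swept and the stack is not changed. -/
theorem StackInv.advance {q : Fin n} {st : List (StackEntry n)} (h : T.StackInv (q.val + 1) st)
    (hy : ∀ e ∈ st, T.x q < T.x e.guard → T.y q ≤ T.y e.guard)
    (hd : T.LeftReflex q → ∀ e ∈ st, 0 < T.depth e (T.vertex q)) : T.StackInv q.val st := by
  constructor
  · intro e he
    have h1 := h.entry e he
    refine ⟨h1.reflex, ?_, h1.sees, h1.odd_obs, h1.y_obs, h1.x_obs, ?_, ?_, ?_⟩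
    · rcases h1.le_guard with h2 | h2 <;> left <;> omega
    · intro a ha hx
      rcases ha.eq_or_lt with h2 | h2
      · obtain rfl : q = a := Fin.ext h2
        exact hy e he hx
      · exact h1.high a h2 hx
    · intro c hc hqc hx
      rcases hqc.eq_or_lt with h2 | h2
      · obtain rfl : q = c := Fin.ext h2
        exact hd hc e he
      · exact h1.under c hc h2 hx
    · exact fun h2 => h1.obs_lt (by omega)
  · refine h.pair.imp_of_mem fun {e f} he hf h1 => ⟨h1.x_lt, h1.y_le, h1.depth_guard, ?_⟩
    intro h2 h3
    rcases h2.eq_or_lt with h4 | h4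
    -- The condition on the obstacle of `e` becomes active exactly now, when the obstacle is swept.
    -- It is adjacent to its guard, so a left convex one is exempt.
    · have h5 := (h.entry e he).obs_lt (by omega)
      obtain h6 : e.obs = q := Fin.ext h4.symm
      rcases T.leftConvex_or_leftReflex (h.entry e he).odd_obs with h7 | h7
      · exact absurd ⟨h7, h5.1⟩ h3
      · rw [h6] at h7 ⊢
        exact hd h7 f hf
    · exact h1.depth_obs h4 h3

theorem StackInv.cons {k : ℕ} {e : StackEntry n} {st : List (StackEntry n)}
    (h : T.StackInv k st) (he : T.EntryInv k e) (hp : ∀ f ∈ st, T.PairInv k e f) :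
    T.StackInv k (e :: st) :=
  ⟨fun f hf => by
    rcases List.mem_cons.1 hf with rfl | hf
    · exact he
    · exact h.entry f hf, List.pairwise_cons.2 ⟨hp, h.pair⟩⟩

/-! ### The invariant of the sweep -/

variable (T)

/-- Some entry of the stack sees `v`. -/
def Covered (st : List (StackEntry n)) (v : Fin n) : Prop := ∃ e ∈ st, T.Sees e.guard v

/-- The left convex vertex `f` has just been swept, its right horizon has been pushed for it, and
the right reflex vertex `w` above `f` is about to replace that entry. -/
def Transient (s : SweepState n) (f w : Fin n) : Prop :=
  T.RightReflex w ∧ w.val + 1 = f.val ∧ f.val = s.unswept ∧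
    ∃ e st, s.stack = e :: st ∧ s.list e.guard = [f] ∧ e.obs = f ∧ T.y e.guard < T.y w

/-- Nonempty lists on the stack ensure that appending to the list of a guard found there yields no
new first vertex. Coverage is required only for those `v` that share a witness with a first vertex.
-/
structure SweepInv (s : SweepState n) : Prop where
  stack : T.StackInv s.unswept s.stack
  nonempty : ∀ e ∈ s.stack, s.list e.guard ≠ []
  covered : ∀ v f w : Fin n, T.LeftConvex v → v.val < s.unswept → f ∈ firstSet s.list →
    T.Reflex w → T.Sees w v → T.Sees w f → T.Covered s.stack v ∨ T.Transient s f w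

/-- No reflex vertex sees two distinct elements of `F`. -/
def Independent (F : Set (Fin n)) : Prop :=
  ∀ u v : Fin n, u ∈ F → v ∈ F → u ≠ v → ¬ ∃ w : Fin n, T.Reflex w ∧ T.Sees w u ∧ T.Sees w v

variable {T}

/-! ### Visibility of left convex vertices -/

theorem Sees.cross {v b g g' : Fin n} (h1 : T.Sees g v) (h2 : T.Sees g' b) (hvb : T.x v < T.x b)
    (hbg : T.x b < T.x g) (hgg : T.x g < T.x g') : T.Sees g' v :=
  Sees.symm (Clear.cross hvb.le hbg hgg h1.symm h2.symm (h1.symm.onOrBelow hvb hbg)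
    (h2.symm.onOrBelow hbg hgg))

theorem Sees.cross_of_le {v b g g' : Fin n} (h1 : T.Sees g v) (h2 : T.Sees g' b)
    (hg : T.Reflex g) (hg' : T.Reflex g') (hvb : T.x v < T.x b)
    (hbg : T.x b < T.x g) (hgg : T.x g ≤ T.x g') : T.Sees g' v := by
  rcases hgg.eq_or_lt with h | h
  · rwa [← hg.eq_of_x_eq hg' h]
  · exact h1.cross h2 hvb hbg h

/-- The floor to the right of `v` and the edge to the left of `q` force the segment to be
horizontal. -/
theorem RightReflex.y_eq_of_sees {v q : Fin n} (hq : T.RightReflex q) (hv : T.LeftConvex v)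
    (hx : T.x v < T.x q) (h : T.Sees q v) : T.y v = T.y q :=
  le_antisymm (h.symm.y_le_of_odd hx hv.odd) (h.symm.y_le_of_even hx hq.even)

theorem Sees.concat {v q g : Fin n} (h1 : T.Sees q v) (h2 : T.Sees g q) (hv : T.LeftConvex v)
    (hq : T.RightReflex q) (hg : T.Reflex g) (hx : T.x v < T.x q) (hxg : T.x q ≤ T.x g)
    (hy : T.y q ≤ T.y g) : T.Sees g v := by
  rcases hxg.eq_or_lt with h | h
  · rwa [← Reflex.eq_of_x_eq (Or.inr hq) hg h]
  · refine Sees.symm (Clear.concat hx h h1.symm h2.symm ?_)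
    have h3 := hq.y_eq_of_sees hv hx h1
    change (T.y q - T.y v) * (T.x g - T.x v) ≤ (T.y g - T.y v) * (T.x q - T.x v)
    rw [h3]
    nlinarith

/-- The order claim with `z` in the role of `b`: `z` sees the guard of `g` because it lies on that
ray above the terrain, and it is not above the segment from `v` to the guard of `e` because `v` is
not below the ray of `e`. -/
theorem sees_of_rayIncident {k : ℕ} {e g : StackEntry n} (he : T.EntryInv k e)
    (hg : T.EntryInv k g) (hx : T.x e.guard < T.x g.guard) {v v₀ : Fin n} (hv : T.LeftConvex v)
    (hvk : v.val < k) (hv₀ : k = v₀.val + 1) {z : ℝ × ℝ} (hz : T.x v₀ ≤ z.1)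
    (habove : T.StrictlyAbove z) (hze : T.RayIncident e z) (hzg : T.RayIncident g z)
    (hs : T.Sees e.guard v) : T.Sees g.guard v := by
  have hxe : T.x e.obs < T.x e.guard := by
    rcases he.x_obs with h | ⟨-, -, h⟩
    · exact h
    · exact absurd (h g.guard) (not_le.2 hx)
  obtain ⟨m, hm0, hm⟩ := he.exists_slope hxe
  obtain ⟨t, ht, hzt⟩ := hze
  obtain ⟨t', ht', hzt'⟩ := hzg
  have ht0 : 0 < t := by
    refine lt_of_le_of_ne ht ?_
    rintro rfl
    have h1 : z = T.vertex e.guard := by rw [hzt]; simp [rayPoint]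
    rw [h1] at habove
    exact lt_irrefl _ (habove _ (T.vertex_mem_points _) rfl)
  have hz1 : z.1 = T.x e.guard + t * (T.x e.obs - T.x e.guard) := by rw [hzt]; rfl
  have hz2 : z.2 = T.y e.guard + t * (T.y e.obs - T.y e.guard) := by rw [hzt]; rfl
  have hz1' : z.1 = T.x g.guard + t' * (T.x g.obs - T.x g.guard) := by rw [hzt']; rfl
  have hz2' : z.2 = T.y g.guard + t' * (T.y g.obs - T.y g.guard) := by rw [hzt']; rfl
  have hzx : z.1 < T.x e.guard := by rw [hz1]; nlinarith
  have hvx : T.x v ≤ z.1 := (T.x_mono (by rw [Fin.le_def]; omega)).trans hz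
  have hline : z.2 = T.y e.guard + m * (z.1 - T.x e.guard) := by rw [hz2, hz1, hm]; ring
  have hclear : T.Clear z (T.vertex g.guard) := by
    refine hg.clear hz (hzx.trans hx) ?_ ?_ ?_ ?_
    · rw [hz2']
      nlinarith [hg.y_obs]
    · intro i j hij hi h1 h2
      exact (habove _ (T.edge_mem_points hij hi h1 h2.le) rfl).le
    · intro l hl
      have := T.lt_of_x_lt (hz.trans_lt hl)
      rw [Fin.lt_def] at this
      omega
    · rw [depth, hz1', hz2']
      apply le_of_eq
      ring
  have hdepth : T.depth e (T.vertex v) ≤ 0 := by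
    -- If the obstacle is unswept, the ray is horizontal and `v` has the height of the guard;
    -- otherwise `v` is to the left of the obstacle.
    by_cases h : e.obs.val < k
    · obtain ⟨h1, h2⟩ := he.obs_lt h
      have h3 := h2.y_eq_of_sees hv (hvx.trans_lt hzx) hs
      have h4 := T.horizontal_step h1 he.odd_obs
      rw [depth_vertex, h3, h4.1]
      apply le_of_eq
      ring
    · exact he.depth_nonpos hs.symm (T.x_lt_of_odd (by rw [Fin.lt_def]; omega) hv.odd)
  rw [depth_eq_of_slope hm] at hdepth
  have h1 : T.y e.guard + m * (T.x v - T.x e.guard) ≤ T.y v :=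
    sub_nonpos.1 (nonpos_of_mul_nonpos_right hdepth (sub_pos.2 hxe))
  refine Sees.symm (Clear.cross hvx hzx hx hs.symm hclear ?_
    (hclear.onOrBelow hz hzx hx))
  change (z.2 - T.y v) * (T.x e.guard - T.x v) ≤ (T.y e.guard - T.y v) * (z.1 - T.x v)
  rw [hline]
  nlinarith [mul_nonneg (sub_nonneg.2 h1) (sub_pos.2 hzx).le]

/-! ### Lists and stacks -/

theorem mem_firstSet_appendTo {L : Fin n → List (Fin n)} {g v f : Fin n}
    (hf : f ∈ firstSet (appendTo L g v)) : f ∈ firstSet L ∨ f = v ∧ L g = [] := by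
  obtain ⟨g', hg', h⟩ := hf
  by_cases hgg : g' = g
  · subst hgg
    simp only [appendTo, Function.update_self] at h
    by_cases hL : L g' = []
    · rw [hL] at h
      exact Or.inr ⟨by simpa using h.symm, hL⟩
    · rw [List.head?_append_of_ne_nil _ hL] at h
      exact Or.inl ⟨g', hL, h⟩
  · refine Or.inl ⟨g', ?_, ?_⟩
    · simpa [outputSet, appendTo, Function.update_of_ne hgg] using hg'
    · simpa [appendTo, Function.update_of_ne hgg] using h

theorem appendTo_ne_nil {L : Fin n → List (Fin n)} {g v g' : Fin n} (h : L g' ≠ []) :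
    appendTo L g v g' ≠ [] := by
  by_cases hgg : g' = g
  · subst hgg
    simp [appendTo]
  · simpa [appendTo, Function.update_of_ne hgg] using h

/-- The moved vertex was already first in its old one-element list, and emptying that list exposes
no other vertex. -/
theorem firstSet_move {L : Fin n → List (Fin n)} {u q p : Fin n} (hu : L u = [p]) :
    firstSet (appendTo (Function.update L u []) q p) ⊆ firstSet L := by
  intro f hf
  rcases mem_firstSet_appendTo hf with ⟨g, hg, h⟩ | ⟨rfl, -⟩
  · by_cases hgu : g = u
    · subst hgu
      simp at h
    · rw [Function.update_of_ne hgu] at h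
      exact ⟨g, by simpa [outputSet, Function.update_of_ne hgu] using hg, h⟩
  · exact ⟨u, by simp [outputSet, hu], by simp [hu]⟩

/-- Once an entry fails `S`, failure passes to the next one. For visibility this makes the guards
seeing a left reflex vertex a prefix of the stack. -/
theorem not_of_adjacent {α : Type*} {S : α → Prop} (l : List α)
    (hadj : ∀ e f, [e, f] <:+: l → S f → S e) (hhead : ∀ a ∈ l.head?, ¬ S a) :
    ∀ f ∈ l, ¬ S f := by
  induction l with
  | nil => simp
  | cons a l ih =>
    have ha : ¬ S a := hhead a (by simp)
    intro f hf
    rcases List.mem_cons.1 hf with rfl | hf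
    · exact ha
    · refine ih (fun e f h => hadj e f (h.trans (List.suffix_cons a l).isInfix)) ?_ f hf
      intro b hb hSb
      cases l with
      | nil => simp at hb
      | cons c l =>
        obtain rfl : c = b := by simpa using hb
        exact ha (hadj a c ⟨[], l, by simp⟩ hSb)

theorem deleteExceptRightmost_sublist (st : List (StackEntry n)) (P : StackEntry n → Prop) :
    (T.deleteExceptRightmost st P).Sublist st := by
  classical
  exact List.filter_sublist

theorem mem_deleteExceptRightmost {st : List (StackEntry n)} {P : StackEntry n → Prop}
    {e : StackEntry n} : e ∈ T.deleteExceptRightmost st P ↔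
      e ∈ st ∧ ¬ (P e ∧ ∃ f ∈ st, P f ∧ T.x e.guard < T.x f.guard) := by
  simp only [deleteExceptRightmost, List.mem_filter, decide_eq_true_eq]

/-- A deleted guard is replaced by the rightmost entry with property `P`, which is never deleted. -/
theorem Covered.deleteExceptRightmost {st : List (StackEntry n)} {P : StackEntry n → Prop}
    {v : Fin n} (h : T.Covered st v) (hr : ∀ e ∈ st, T.Reflex e.guard)
    (hP : ∀ e ∈ st, ∀ g ∈ st, P e → P g → T.x e.guard < T.x g.guard → T.Sees e.guard v →
      T.Sees g.guard v) : T.Covered (T.deleteExceptRightmost st P) v := by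
  obtain ⟨e, he, hs⟩ := h
  by_cases hd : P e ∧ ∃ f ∈ st, P f ∧ T.x e.guard < T.x f.guard
  · have hfin : {f | f ∈ st ∧ P f}.Finite := st.finite_toSet.subset fun f hf => hf.1
    obtain ⟨g, ⟨hg, hPg⟩, hmax⟩ := Set.exists_max_image _ (fun f => T.x f.guard) hfin ⟨e, he, hd.1⟩
    refine ⟨g, mem_deleteExceptRightmost.2 ⟨hg, ?_⟩, ?_⟩
    · rintro ⟨-, f, hf, hPf, hlt⟩
      exact absurd (hmax f ⟨hf, hPf⟩) (not_le.2 hlt)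
    · rcases (hmax e ⟨he, hd.1⟩).eq_or_lt with h1 | h1
      · rwa [← (hr e he).eq_of_x_eq (hr g hg) h1]
      · exact hP e he g hg hd.1 hPg h1 hs
  · exact ⟨e, mem_deleteExceptRightmost.2 ⟨he, hd⟩, hs⟩

theorem StackInv.pairInv_of_x_lt {k : ℕ} {st : List (StackEntry n)} (h : T.StackInv k st)
    {e g : StackEntry n} (he : e ∈ st) (hg : g ∈ st) (hx : T.x e.guard < T.x g.guard) :
    T.PairInv k e g := by
  obtain ⟨l₁, l₂, rfl⟩ := List.append_of_mem he
  have hp := h.pair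
  rw [List.pairwise_append, List.pairwise_cons] at hp
  rcases List.mem_append.1 hg with hg | hg
  · exact absurd (hp.2.2 g hg e List.mem_cons_self).x_lt (not_lt.2 hx.le)
  · rcases List.mem_cons.1 hg with rfl | hg
    · exact absurd hx (lt_irrefl _)
    · exact hp.2.1.1 g hg

/-- Protects the transient entry: between its guard and its obstacle the ray either lies on the
terrain or stays strictly below the rays of the entries further down the stack, except perhaps at
the guard. -/
theorem EntryInv.not_rayIncident {k : ℕ} {e g : StackEntry n} (he : T.EntryInv k e)
    (hp : T.PairInv k e g) (hk : k ≤ e.obs.val) {z : ℝ × ℝ} (hz : T.x e.obs ≤ z.1)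
    (habove : T.StrictlyAbove z) (hze : T.RayIncident e z) : ¬ T.RayIncident g z := by
  have hxe : T.x e.obs < T.x e.guard := by
    rcases he.x_obs with h | ⟨-, -, h⟩
    · exact h
    · exact absurd (h g.guard) (not_le.2 hp.x_lt)
  rintro ⟨t', ht', hzt'⟩
  obtain ⟨t, ht, hzt⟩ := hze
  have ht0 : 0 < t := by
    refine lt_of_le_of_ne ht ?_
    rintro rfl
    have h1 : z = T.vertex e.guard := by rw [hzt]; simp [rayPoint]
    rw [h1] at habove
    exact lt_irrefl _ (habove _ (T.vertex_mem_points _) rfl)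
  have hz1 : z.1 = T.x e.guard + t * (T.x e.obs - T.x e.guard) := by rw [hzt]; rfl
  have hz2 : z.2 = T.y e.guard + t * (T.y e.obs - T.y e.guard) := by rw [hzt]; rfl
  have hz1' : z.1 = T.x g.guard + t' * (T.x g.obs - T.x g.guard) := by rw [hzt']; rfl
  have hz2' : z.2 = T.y g.guard + t' * (T.y g.obs - T.y g.guard) := by rw [hzt']; rfl
  have ht1 : t ≤ 1 := by
    by_contra h
    push Not at h
    nlinarith
  by_cases hexc : T.LeftConvex e.obs ∧ e.obs.val + 1 = e.guard.val
  · have h1 := T.horizontal_step hexc.2 he.odd_obs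
    have h2 := habove _ (T.edge_mem_points (a := z.1) hexc.2 he.odd_obs hz (by nlinarith)) rfl
    rw [hz2, ← h1.1] at h2
    simp at h2
  · have h1 := hp.depth_obs hk hexc
    have h2 := hp.depth_guard
    have h3 : T.depth g z = 0 := by
      rw [depth, hz1', hz2']; ring
    have h4 : T.depth g z = (1 - t) * T.depth g (T.vertex e.guard) +
        t * T.depth g (T.vertex e.obs) := by
      rw [depth_vertex, depth_vertex, depth, hz1, hz2]; ring
    have h5 := mul_pos ht0 h1
    have h6 := mul_nonneg (sub_nonneg.2 ht1) h2
    linarith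

/-! ### The steps preserve the invariant -/

theorem SweepInv.handleRightConvex {s : SweepState n} (h : T.SweepInv s) {q : Fin n}
    (hk : s.unswept = q.val + 1) (hq : T.RightConvex q) :
    T.SweepInv (handleRightConvex q s) := by
  have hst := h.stack
  rw [hk] at hst
  refine ⟨hst.advance ?_ ?_, h.nonempty, ?_⟩
  · obtain ⟨w, hw, hwx, hwy⟩ := hq
    intro e he hx
    exact hwy.le.trans ((hst.entry e he).high w hw.le (by rwa [← hwx]))
  · exact fun h' => absurd (Or.inl h') hq.not_reflex
  · intro v f w hv hvk hf hw h1 h2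
    change v.val < q.val at hvk
    rcases h.covered v f w hv (by omega) hf hw h1 h2 with h3 | ⟨h3, h4, h5, -⟩
    · exact Or.inl h3
    · obtain rfl : w = q := Fin.ext (by omega)
      exact absurd hw hq.not_reflex

theorem SweepInv.handleIntersection {s : SweepState n} (h : T.SweepInv s) {z : ℝ × ℝ}
    (hz : T.NextIntersection s z) : T.SweepInv (T.handleIntersection z s) := by
  obtain ⟨⟨-, -, -, -, habove⟩, -, v₀, hk, hv₀⟩ := hz
  refine ⟨h.stack.sublist (deleteExceptRightmost_sublist _ _), fun e he =>
    h.nonempty e ((deleteExceptRightmost_sublist _ _).subset he), ?_⟩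
  intro v f w hv hvk hf hw h1 h2
  rcases h.covered v f w hv hvk hf hw h1 h2 with h3 | ⟨h3, h4, h5, e, st, hst, hL, ho, hy⟩
  · refine Or.inl (h3.deleteExceptRightmost (fun e he => (h.stack.entry e he).reflex) ?_)
    intro e he g hg hPe hPg hx hs
    exact sees_of_rayIncident (h.stack.entry e he) (h.stack.entry g hg) hx hv hvk hk hv₀ habove
      hPe hPg hs
  · right
    have he : e ∈ s.stack := by rw [hst]; exact List.mem_cons_self
    have hei := h.stack.entry e he
    have hxv : T.x e.obs = T.x v₀ := by
      obtain ⟨f', hf', hx, -⟩ := h3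
      obtain rfl : f' = f := Fin.ext (by omega)
      obtain rfl : w = v₀ := Fin.ext (by omega)
      rw [ho, hx]
    have hko : s.unswept ≤ e.obs.val := by rw [ho, h5]
    have hne : ¬ (T.RayIncident e z ∧ ∃ g ∈ s.stack, T.RayIncident g z ∧
        T.x e.guard < T.x g.guard) := by
      rintro ⟨hez, g, hg, hgz, hlt⟩
      exact hei.not_rayIncident (h.stack.pairInv_of_x_lt he hg hlt) hko (hxv.trans_le hv₀) habove
        hez hgz
    classical
    refine ⟨h3, h4, h5, e, st.filter fun e => decide (¬ (T.RayIncident e z ∧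
      ∃ g ∈ s.stack, T.RayIncident g z ∧ T.x e.guard < T.x g.guard)), ?_, hL, ho, hy⟩
    change List.filter _ s.stack = _
    conv_lhs => arg 2; rw [hst]
    rw [List.filter_cons_of_pos (by rw [decide_eq_true_eq]; exact hne)]

theorem SweepInv.handleLeftReflex {s : SweepState n} (h : T.SweepInv s) {q : Fin n}
    (hk : s.unswept = q.val + 1) (hq : T.LeftReflex q)
    (hnext : ∀ z, T.Pending s.stack z → z.1 ≤ T.x q) : T.SweepInv (T.handleLeftReflex q s) := by
  classical
  have hst := h.stack
  rw [hk] at hst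
  have hcov : ∀ v f w : Fin n, T.LeftConvex v → v.val < q.val → f ∈ firstSet s.list →
      T.Reflex w → T.Sees w v → T.Sees w f → T.Covered s.stack v := by
    intro v f w hv hvk hf hw h1 h2
    rcases h.covered v f w hv (by omega) hf hw h1 h2 with h3 | ⟨h3, h4, h5, -⟩
    · exact h3
    · obtain rfl : w = q := Fin.ext (by omega)
      exact absurd h3.even (Nat.not_even_iff_odd.2 hq.odd)
  set S : StackEntry n → Bool := fun e => decide (T.Sees e.guard q) with hS
  have hsplit : s.stack.takeWhile S ++ s.stack.dropWhile S = s.stack :=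
    List.takeWhile_append_dropWhile
  have hrest : ∀ e ∈ s.stack.dropWhile S, ¬ T.Sees e.guard q := by
    refine not_of_adjacent _ (fun e f hef hs => ?_) ?_
    · have hef' := hef.trans (List.dropWhile_suffix S).isInfix
      have hmem := hef'.sublist.subset
      refine sees_of_adjacent (hst.entry e (hmem (by simp))) (hst.entry f (hmem (by simp))) ?_ hq rfl
        hef' hnext hs
      have := hst.pair.sublist hef'.sublist
      simpa using this
    · intro a ha
      have := List.head?_dropWhile_not S s.stack
      rw [Option.mem_def] at ha
      rw [ha] at this
      simpa [hS] using this
  have hadv : T.StackInv q.val (s.stack.dropWhile S) := by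
    have h1 := hst.sublist (List.dropWhile_sublist S)
    exact h1.advance (fun e he _ => (h1.entry e he).y_le_of_odd hq.odd rfl)
      (fun _ e he => (h1.entry e he).depth_pos_of_not_sees hq.odd rfl (hrest e he))
  have hdef : T.handleLeftReflex q s = match (s.stack.takeWhile S).getLast? with
    | none => ⟨q.val, s.stack, s.list⟩
    | some e => ⟨q.val, ⟨e.guard, q⟩ :: s.stack.dropWhile S, s.list⟩ := rfl
  rw [hdef]
  rcases List.eq_nil_or_concat (s.stack.takeWhile S) with hp | ⟨l, e, hp⟩
  · rw [hp] at hsplit ⊢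
    simp only [List.nil_append] at hsplit
    rw [hsplit] at hadv
    exact ⟨hadv, h.nonempty, fun v f w hv hvk hf hw h1 h2 =>
      Or.inl (hcov v f w hv hvk hf hw h1 h2)⟩
  · have hpop : ∀ a ∈ l ++ [e], T.Sees a.guard q := by
      intro a ha
      rw [← List.concat_eq_append, ← hp] at ha
      simpa [hS] using List.mem_takeWhile_imp ha
    rw [hp] at hsplit ⊢
    rw [List.concat_eq_append] at hsplit ⊢
    simp only [List.getLast?_append, List.getLast?_singleton, Option.some_or]
    have hpair := hst.pair
    rw [← hsplit, List.pairwise_append, List.pairwise_append] at hpair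
    have hmem : ∀ a ∈ l ++ [e], a ∈ s.stack := fun a ha => by
      rw [← hsplit]; exact List.mem_append_left _ ha
    have hmem' : ∀ a ∈ s.stack.dropWhile S, a ∈ s.stack := fun a ha => by
      rw [← hsplit]; exact List.mem_append_right _ ha
    have hes : e ∈ s.stack := hmem e (by simp)
    have hei := hst.entry e hes
    refine ⟨hadv.cons ?_ ?_, ?_, ?_⟩
    · refine ⟨hei.reflex, Or.inl (Nat.le_of_succ_le (hei.le_guard_of_odd hq.odd rfl)),
        hpop e (by simp), hq.odd, hei.y_le_of_odd hq.odd rfl,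
        Or.inl (hei.x_lt_of_odd hq.odd rfl), ?_, ?_, fun h => absurd h (lt_irrefl _)⟩
      · intro a ha hx
        rcases ha.eq_or_lt with h1 | h1
        · obtain rfl : q = a := Fin.ext h1
          exact hei.y_le_of_odd hq.odd rfl
        · exact hei.high a h1 hx
      · intro c hc hqc hx
        exact absurd (T.lt_of_x_lt hx) (not_lt.2 hqc)
    · intro f hf
      have h1 := hpair.2.2 e (by simp) f hf
      exact ⟨h1.x_lt, h1.y_le, h1.depth_guard, fun _ _ =>
        (hst.entry f (hmem' f hf)).depth_pos_of_not_sees hq.odd rfl (hrest f hf)⟩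
    · intro a ha
      rcases List.mem_cons.1 ha with rfl | ha
      · exact h.nonempty e hes
      · exact h.nonempty a (hmem' a ha)
    · intro v f w hv hvk hf hw h1 h2
      left
      obtain ⟨a, ha, hs⟩ := hcov v f w hv hvk hf hw h1 h2
      rw [← hsplit, List.mem_append] at ha
      rcases ha with ha | ha
      -- The last popped guard is the rightmost popped one and sees `q`, so it inherits what the
      -- others see further left.
      · refine ⟨⟨e.guard, q⟩, List.mem_cons_self, ?_⟩
        refine hs.cross_of_le (hpop e (by simp)) (hst.entry a (hmem a ha)).reflex hei.reflex
          (T.x_lt_of_odd hvk hv.odd) ((hst.entry a (hmem a ha)).x_lt_of_odd hq.odd rfl) ?_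
        rcases List.mem_append.1 ha with ha | ha
        · exact (hpair.1.2.2 a ha e (by simp)).x_lt.le
        · rw [List.mem_singleton.1 ha]
      · exact ⟨a, List.mem_cons_of_mem _ ha, hs⟩

/-! ### The right horizon and the left convex event -/

theorem sees_of_horizontal {i j : Fin n} (hij : i.val + 1 = j.val) (hi : Odd i.val) :
    T.Sees i j := by
  have h := T.horizontal_step hij hi
  refine (T.clear_iff_slope (P := T.vertex i) (Q := T.vertex j) (m := 0) h.2 ?_).2 ?_
  · change T.y j = T.y i + _
    rw [h.1]; ring
  · intro a h1 h2 hS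
    have := hS _ (T.edge_mem_points hij hi h1 h2) rfl
    change T.y i + 0 * _ < T.y i at this
    simp at this

/-- A reflex vertex strictly to the right of `q` always sees it: the right end of its floor if the
terrain drops there, or else the top of the wall. -/
theorem IsRightHorizon.x_lt {q r : Fin n} (hr : T.IsRightHorizon q r) (hq : T.LeftConvex q)
    (hn : q.val + 1 < n) : T.x q < T.x r := by
  have ho := hq.odd
  have hn2 : q.val + 1 + 1 < n := by
    rcases Nat.lt_or_ge (q.val + 1 + 1) n with h | h
    · exact h
    · have h1 := T.even_card
      rw [show n = q.val + 1 + 1 by omega, Nat.even_add_one, Nat.even_add_one, not_not] at h1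
      exact absurd h1 (Nat.not_even_iff_odd.2 ho)
  have h1 := T.horizontal_step (i := q) (j := ⟨q.val + 1, hn⟩) rfl ho
  have h2 := T.vertical_step (i := ⟨q.val + 1, hn⟩) (j := ⟨q.val + 1 + 1, hn2⟩) rfl ho.add_one
  rcases lt_or_gt_of_ne h2.2 with h3 | h3
  · refine lt_of_lt_of_le (h1.2.trans_le h2.1.le)
      (hr.2.2 ⟨q.val + 1 + 1, hn2⟩ (Or.inl ⟨_, rfl, h2.1, h3⟩) (Sees.symm ?_))
    refine clear_of_leftReflex (P := T.vertex q) (p := q) le_rfl (h1.2.trans_le h2.1.le)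
      (h1.1.le.trans h3.le) (fun i j hij _ h4 h5 => edge_right_le (Or.inl ho) hij h4 h5) ?_
    intro l _ h4 h5
    have h6 : q < l := T.lt_of_x_lt h4
    have h7 := T.x_mono (i := ⟨q.val + 1, hn⟩) (j := l) h6
    rw [← h2.1] at h5
    exact absurd h5 (not_lt.2 h7)
  · exact lt_of_lt_of_le h1.2 (hr.2.2 ⟨q.val + 1, hn⟩ (Or.inr ⟨_, rfl, h2.1, h3⟩)
      (sees_of_horizontal rfl ho).symm)

theorem IsRightHorizon.entryInv {q r : Fin n} (hr : T.IsRightHorizon q r)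
    (hq : T.LeftConvex q) : T.EntryInv q.val ⟨r, q⟩ := by
  rcases Nat.lt_or_ge (q.val + 1) n with hn | hn
  · have hx := hr.x_lt hq hn
    have hlt := T.lt_of_x_lt hx
    have hy := hr.2.1.symm.y_le_of_odd hx hq.odd
    refine ⟨hr.1, Or.inl hlt.le, hr.2.1, hq.odd, hy, Or.inl hx, ?_, ?_,
      fun h => absurd h (lt_irrefl _)⟩
    · intro a ha hax
      rcases ha.eq_or_lt with h | h
      · obtain rfl : q = a := Fin.ext h
        exact hy
      · have h1 := hr.2.1.symm.onOrBelow (T.x_lt_of_odd (j := a) h hq.odd) hax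
        change (T.y a - T.y q) * (T.x r - T.x q) ≤ (T.y r - T.y q) * (T.x a - T.x q) at h1
        change T.x a < T.x r at hax
        change T.y a ≤ T.y r
        by_contra h2
        push Not at h2
        nlinarith
    · exact fun c _ hc hcx => absurd (T.lt_of_x_lt hcx) (not_lt.2 hc)
  -- For the last vertex the right horizon is the vertex right above it; this is the origin of the
  -- vertical ray.
  · have hmax : ∀ a : Fin n, a ≤ q := fun a => by rw [Fin.le_def]; omega
    have hx : T.x q = T.x r := le_antisymm (hq.x_le_of_sees hr.2.1) (T.x_mono (hmax r))
    obtain ⟨u, hu, hux, huy⟩ := id hq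
    obtain rfl : r = u := hr.1.eq_of_x_eq (Or.inr ⟨q, hu, hux, huy⟩) (hx.symm.trans hux.symm)
    refine ⟨hr.1, Or.inr ⟨hu, by omega⟩, hr.2.1, hq.odd, huy.le,
      Or.inr ⟨hx, huy, fun a => (T.x_mono (hmax a)).trans hx.le⟩, ?_, ?_,
      fun h => absurd h (lt_irrefl _)⟩
    · intro a ha hax
      obtain rfl : a = q := le_antisymm (hmax a) ha
      exact absurd hax (not_lt.2 hx.ge)
    · exact fun c _ hc hcx => absurd (T.lt_of_x_lt hcx) (not_lt.2 hc)

theorem IsRightHorizon.pairInv {q r : Fin n} (hr : T.IsRightHorizon q r) (hq : T.LeftConvex q)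
    {f : StackEntry n} (hf : T.EntryInv (q.val + 1) f) (hs : ¬ T.Sees f.guard q)
    (hx : T.x r < T.x f.guard) : T.PairInv q.val ⟨r, q⟩ f := by
  have hxq := hr.x_lt hq ((hf.le_guard_of_odd hq.odd rfl).trans_lt f.guard.isLt)
  have hlt : q.val + 1 ≤ r.val := T.lt_of_x_lt hxq
  have hd := hf.depth_pos_of_not_sees hq.odd rfl hs
  refine ⟨hx, hf.high r hlt hx, ?_, fun _ _ => hd⟩
  -- A left reflex `r` is swept, hence not below-tested anew; for a right reflex `r` the segment
  -- `qr` is horizontal while the ray of `f` does not descend from `q` to `r`.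
  rcases hr.1 with h | h
  · exact hf.depth_nonneg h hlt hx
  · have hy := h.y_eq_of_sees hq hxq hr.2.1
    rw [depth_vertex, hy] at hd
    change 0 ≤ T.depth f (T.vertex r)
    rw [depth_vertex]
    nlinarith [hf.y_obs]

theorem handleLeftConvex_spec {q r : Fin n} (s : SweepState n)
    (hst : T.StackInv (q.val + 1) s.stack) (hr : T.IsRightHorizon q r) :
    ∃ popped rest, s.stack = popped ++ rest ∧
      (∀ e ∈ popped, ¬ T.Sees e.guard q ∧ T.x e.guard ≤ T.x r) ∧
      ((∃ e ∈ rest, T.Sees e.guard q ∧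
          T.handleLeftConvex q r s = ⟨q.val, rest, appendTo s.list e.guard q⟩) ∨
        (∀ e ∈ rest, ¬ T.Sees e.guard q ∧ T.x r < T.x e.guard) ∧
          T.handleLeftConvex q r s = ⟨q.val, ⟨r, q⟩ :: rest, appendTo s.list r q⟩) := by
  classical
  set D : StackEntry n → Bool :=
    fun e => decide (¬ (T.Sees e.guard q ∨ T.x r < T.x e.guard)) with hD
  refine ⟨s.stack.takeWhile D, s.stack.dropWhile D, List.takeWhile_append_dropWhile.symm,
    fun e he => ?_, ?_⟩
  · have := List.mem_takeWhile_imp he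
    rw [hD, decide_eq_true_eq, not_or, not_lt] at this
    exact this
  · have hdef : T.handleLeftConvex q r s = match s.stack.dropWhile D with
      | [] => ⟨q.val, ⟨r, q⟩ :: s.stack.dropWhile D, appendTo s.list r q⟩
      | e :: _ => if T.Sees e.guard q then
          ⟨q.val, s.stack.dropWhile D, appendTo s.list e.guard q⟩
        else ⟨q.val, ⟨r, q⟩ :: s.stack.dropWhile D, appendTo s.list r q⟩ := rfl
    rw [hdef]
    have hhead := List.head?_dropWhile_not D s.stack
    have hpair := hst.pair.sublist (List.dropWhile_sublist D)
    have hmem := (List.dropWhile_sublist D (l := s.stack)).subset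
    generalize s.stack.dropWhile D = l at hhead hpair hmem ⊢
    cases l with
    | nil => exact Or.inr ⟨by simp, rfl⟩
    | cons e l =>
      by_cases hs : T.Sees e.guard q
      · exact Or.inl ⟨e, List.mem_cons_self, hs, by simp [hs]⟩
      · have hx : T.x r < T.x e.guard := by simpa [hD, hs] using hhead
        refine Or.inr ⟨fun f hf => ?_, by simp [hs]⟩
        rcases List.mem_cons.1 hf with rfl | hf'
        · exact ⟨hs, hx⟩
        · have h1 := hx.trans ((List.pairwise_cons.1 hpair).1 f hf').x_lt
          exact ⟨fun h => absurd (hr.2.2 _ (hst.entry f (hmem hf)).reflex h) (not_le.2 h1), h1⟩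

theorem SweepInv.covered_of_odd {s : SweepState n} (h : T.SweepInv s) {q v f w : Fin n}
    (hk : s.unswept = q.val + 1) (hq : Odd q.val) (hv : T.LeftConvex v) (hvk : v.val ≤ q.val)
    (hf : f ∈ firstSet s.list) (hw : T.Reflex w) (h1 : T.Sees w v) (h2 : T.Sees w f) :
    T.Covered s.stack v := by
  rcases h.covered v f w hv (by omega) hf hw h1 h2 with h3 | ⟨h3, h4, h5, -⟩
  · exact h3
  · obtain rfl : w = q := Fin.ext (by omega)
    exact absurd h3.even (Nat.not_even_iff_odd.2 hq)

theorem SweepInv.handleLeftConvex {s : SweepState n} (h : T.SweepInv s) {q r : Fin n}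
    (hk : s.unswept = q.val + 1) (hq : T.LeftConvex q) (hr : T.IsRightHorizon q r) :
    T.SweepInv (T.handleLeftConvex q r s) := by
  have hst := h.stack
  rw [hk] at hst
  obtain ⟨popped, rest, hsplit, hpop, hcase⟩ := handleLeftConvex_spec s hst hr
  have hmem : ∀ a ∈ popped, a ∈ s.stack := fun a ha => by
    rw [hsplit]; exact List.mem_append_left _ ha
  have hmem' : ∀ a ∈ rest, a ∈ s.stack := fun a ha => by
    rw [hsplit]; exact List.mem_append_right _ ha
  have hadv : T.StackInv q.val rest := by
    have h1 : T.StackInv (q.val + 1) rest :=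
      hst.sublist (by rw [hsplit]; exact List.sublist_append_right _ _)
    exact h1.advance (fun e he _ => (h1.entry e he).y_le_of_odd hq.odd rfl)
      (fun h' => absurd h' hq.not_leftReflex)
  have hcov := fun (v f w : Fin n) hv (hvk : v.val < q.val) hf hw h1 h2 =>
    h.covered_of_odd (v := v) (f := f) (w := w) hk hq.odd hv hvk.le hf hw h1 h2
  have hpair := hst.pair
  rw [hsplit, List.pairwise_append] at hpair
  rcases hcase with ⟨g, hg, hgs, heq⟩ | ⟨hrest, heq⟩
  · rw [heq]
    refine ⟨hadv, fun e he => appendTo_ne_nil (h.nonempty e (hmem' e he)), ?_⟩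
    intro v f w hv hvk hf hw h1 h2
    left
    have hf' : f ∈ firstSet s.list := by
      rcases mem_firstSet_appendTo hf with hf | ⟨-, hf⟩
      · exact hf
      · exact absurd hf (h.nonempty g (hmem' g hg))
    obtain ⟨e, he, hs⟩ := hcov v f w hv hvk hf' hw h1 h2
    rw [hsplit, List.mem_append] at he
    rcases he with he | he
    · exact ⟨g, hg, hs.cross hgs (T.x_lt_of_odd hvk hv.odd)
        ((hst.entry e (hmem e he)).x_lt_of_odd hq.odd rfl) (hpair.2.2 e he g hg).x_lt⟩
    · exact ⟨e, he, hs⟩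
  · rw [heq]
    refine ⟨hadv.cons (hr.entryInv hq) fun f hf => hr.pairInv hq (hst.entry f (hmem' f hf))
      (hrest f hf).1 (hrest f hf).2, ?_, ?_⟩
    · intro e he
      rcases List.mem_cons.1 he with rfl | he
      · simp [appendTo]
      · exact appendTo_ne_nil (h.nonempty e (hmem' e he))
    · intro v f w hv hvk hf hw h1 h2
      have hvq : T.x v < T.x q := T.x_lt_of_odd hvk hv.odd
      rcases mem_firstSet_appendTo hf with hf | ⟨rfl, hL⟩
      · left
        obtain ⟨e, he, hs⟩ := hcov v f w hv hvk hf hw h1 h2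
        rw [hsplit, List.mem_append] at he
        rcases he with he | he
        · exact ⟨⟨r, q⟩, List.mem_cons_self, hs.cross_of_le hr.2.1
            (hst.entry e (hmem e he)).reflex hr.1 hvq
            ((hst.entry e (hmem e he)).x_lt_of_odd hq.odd rfl) (hpop e he).2⟩
        · exact ⟨e, List.mem_cons_of_mem _ he, hs⟩
      · have hwr := hr.2.2 w hw h2
        rcases (hq.x_le_of_sees h2).eq_or_lt with h3 | h3
        · obtain ⟨u, hu, hux, huy⟩ := id hq
          have hur : T.RightReflex u := ⟨f, hu, hux, huy⟩
          obtain rfl : w = u := hw.eq_of_x_eq (Or.inr hur) (h3.symm.trans hux.symm)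
          -- The witness `w` is right above `f`. If `r` is lower than `w`, coverage waits for the
          -- event of `w`; otherwise `r` sees `w`, and the horizontal view from `w` to `v` extends
          -- to `r`.
          rcases lt_or_ge (T.y r) (T.y w) with h4 | h4
          · exact Or.inr ⟨hur, hu, rfl, _, _, rfl, by simp [appendTo, hL], rfl, h4⟩
          · refine Or.inl ⟨⟨r, f⟩, List.mem_cons_self, ?_⟩
            change T.Sees r v
            rcases hwr.eq_or_lt with h5 | h5
            · rwa [← hw.eq_of_x_eq hr.1 h5]
            · refine h1.concat (Sees.symm ?_) hv hur hr.1 (by rwa [hux]) h5.le h4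
              exact Clear.raise (P := T.vertex f) (hux.symm.trans_lt h5) hux huy.le hr.2.1.symm
        · exact Or.inl ⟨⟨r, f⟩, List.mem_cons_self, h1.cross_of_le hr.2.1 hw hr.1 hvq h3 hwr⟩

/-- If `q` becomes first in a list, no entry sees it: popped ones by the popping rule, the others
because they are right of its right horizon. By coverage, no reflex vertex then sees both `q` and an
earlier first vertex. -/
theorem SweepInv.independent_handleLeftConvex {s : SweepState n} (h : T.SweepInv s)
    (hi : T.Independent (firstSet s.list)) {q r : Fin n} (hk : s.unswept = q.val + 1)
    (hq : T.LeftConvex q) (hr : T.IsRightHorizon q r) :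
    T.Independent (firstSet (T.handleLeftConvex q r s).list) := by
  have hst := h.stack
  rw [hk] at hst
  obtain ⟨popped, rest, hsplit, hpop, hcase⟩ := handleLeftConvex_spec s hst hr
  rcases hcase with ⟨g, hg, hgs, heq⟩ | ⟨hrest, heq⟩
  · rw [heq]
    have key : ∀ f ∈ firstSet (appendTo s.list g.guard q), f ∈ firstSet s.list := by
      intro f hf
      rcases mem_firstSet_appendTo hf with hf | ⟨-, hf⟩
      · exact hf
      · exact absurd hf (h.nonempty g (by rw [hsplit]; exact List.mem_append_right _ hg))
    exact fun u v hu hv => hi u v (key u hu) (key v hv)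
  · rw [heq]
    have key : ∀ f ∈ firstSet s.list, ∀ w, T.Reflex w → T.Sees w q → ¬ T.Sees w f := by
      intro f hf w hw h1 h2
      obtain ⟨e, he, hs⟩ := h.covered_of_odd hk hq.odd hq le_rfl hf hw h1 h2
      rw [hsplit, List.mem_append] at he
      rcases he with he | he
      · exact (hpop e he).1 hs
      · exact (hrest e he).1 hs
    rintro u v hu hv huv ⟨w, hw, h1, h2⟩
    rcases mem_firstSet_appendTo hu with hu' | ⟨hu', -⟩ <;>
      rcases mem_firstSet_appendTo hv with hv' | ⟨hv', -⟩
    · exact hi u v hu' hv' huv ⟨w, hw, h1, h2⟩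
    · exact key u hu' w hw (hv' ▸ h2) h1
    · exact key v hv' w hw (hu' ▸ h1) h2
    · exact huv (hu'.trans hv'.symm)

/-! ### The right reflex event -/

theorem popLower_spec (q : Fin n) (s : SweepState n) :
    ∃ popped rest, s.stack = popped ++ rest ∧ (∀ e ∈ popped, T.y e.guard < T.y q) ∧
      (∀ e ∈ rest.head?, T.y q ≤ T.y e.guard) ∧
      ((¬ (∃ u st p, s.stack = u :: st ∧ s.list u.guard = [p] ∧ T.y u.guard < T.y q) ∧
          T.popLower q s = ⟨q.val, rest, s.list⟩) ∨
        ∃ u st p, s.stack = u :: st ∧ s.list u.guard = [p] ∧ T.y u.guard < T.y q ∧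
          T.popLower q s =
            ⟨q.val, ⟨q, pred q⟩ :: rest, appendTo (Function.update s.list u.guard []) q p⟩) := by
  classical
  set D : StackEntry n → Bool := fun e => decide (T.y e.guard < T.y q) with hD
  refine ⟨s.stack.takeWhile D, s.stack.dropWhile D, List.takeWhile_append_dropWhile.symm,
    fun e he => by simpa [hD] using List.mem_takeWhile_imp he, fun e he => ?_, ?_⟩
  · have := List.head?_dropWhile_not D s.stack
    rw [Option.mem_def] at he
    rw [he] at this
    simpa [hD] using this
  by_cases hex : ∃ u st p, s.stack = u :: st ∧ s.list u.guard = [p] ∧ T.y u.guard < T.y q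
  · right
    obtain ⟨u, st, p, h1, h2, h3⟩ := hex
    refine ⟨u, st, p, h1, h2, h3, ?_⟩
    simp only [popLower, h1, h2, if_pos h3]
    rfl
  · refine Or.inl ⟨hex, ?_⟩
    unfold popLower
    dsimp only
    split
    · rfl
    · next u st h1 =>
      split
      · next p h2 =>
        rw [if_neg fun h3 => hex ⟨u, st, p, h1, h2, h3⟩]
      · rfl

theorem firstSet_handleRightReflex (q : Fin n) (s : SweepState n) :
    firstSet (T.handleRightReflex q s).list ⊆ firstSet s.list := by
  obtain ⟨_, _, _, _, _, ⟨_, h⟩ | ⟨u, _, _, _, hu, _, h⟩⟩ := popLower_spec (T := T) q s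
  · rw [handleRightReflex, h]
  · rw [handleRightReflex, h]
    exact firstSet_move hu

theorem RightReflex.entryInv {q : Fin n} (hq : T.RightReflex q) (hpos : 0 < q.val) :
    T.EntryInv q.val ⟨q, pred q⟩ := by
  have hp : (pred q).val + 1 = q.val := by simp only [pred]; omega
  have ho : Odd (pred q).val := by
    have := hq.even
    rwa [← hp, Nat.even_add_one, Nat.not_even_iff_odd] at this
  have hs := T.horizontal_step hp ho
  refine ⟨Or.inr hq, Or.inl le_rfl, (sees_of_horizontal hp ho).symm, ho, hs.1.le, Or.inl hs.2,
    ?_, ?_, fun _ => ⟨hp, hq⟩⟩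
  · exact fun a ha hx => absurd (T.lt_of_x_lt hx) (not_lt.2 ha)
  · exact fun c _ hc hx => absurd (T.lt_of_x_lt (hx.trans hs.2)) (not_lt.2 hc)

theorem SweepInv.handleRightReflex {s : SweepState n} (h : T.SweepInv s) {q : Fin n}
    (hk : s.unswept = q.val + 1) (hq : T.RightReflex q) (hpos : 0 < q.val) :
    T.SweepInv (T.handleRightReflex q s) := by
  have hst := h.stack
  rw [hk] at hst
  obtain ⟨popped, rest, hsplit, hpop, hhead, hcase⟩ := popLower_spec (T := T) q s
  have hmem : ∀ a ∈ popped, a ∈ s.stack := fun a ha => by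
    rw [hsplit]; exact List.mem_append_left _ ha
  have hmem' : ∀ a ∈ rest, a ∈ s.stack := fun a ha => by
    rw [hsplit]; exact List.mem_append_right _ ha
  have hrest : T.StackInv (q.val + 1) rest :=
    hst.sublist (by rw [hsplit]; exact List.sublist_append_right _ _)
  have hyrest : ∀ e ∈ rest, T.y q ≤ T.y e.guard := by
    have hp := hrest.pair
    intro e he
    cases rest with
    | nil => simp at he
    | cons a l =>
      have ha := hhead a (by simp)
      rcases List.mem_cons.1 he with rfl | he
      · exact ha
      · exact ha.trans ((List.pairwise_cons.1 hp).1 e he).y_le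
  have hxq : ∀ e ∈ s.stack, T.x q ≤ T.x e.guard := fun e he => T.x_mono (by
    have := (hst.entry e he).le_guard
    rw [Fin.le_def]; omega)
  have hadv : T.StackInv q.val rest := hrest.advance (fun e he _ => hyrest e he)
    (fun h' => absurd hq.even (Nat.not_even_iff_odd.2 h'.odd))
  have hcov : ∀ v, T.LeftConvex v → v.val < q.val → T.Covered s.stack v → T.Covered rest v := by
    rintro v hv hvk ⟨e, he, hs⟩
    have hvq : T.x v < T.x q := T.x_lt_of_odd hvk hv.odd
    have he' := he
    rw [hsplit, List.mem_append] at he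
    rcases he with he | he
    · exfalso
      have hy := hpop e he
      rcases (hxq e he').eq_or_lt with h1 | h1
      · rw [← Reflex.eq_of_x_eq (Or.inr hq) (hst.entry e he').reflex h1] at hy
        exact lt_irrefl _ hy
      -- A popped guard is lower than `q` but not lower than `v`, so `q` would rise above the
      -- segment from `v` to that guard.
      · have h2 := hs.symm.onOrBelow hvq h1
        have h3 := hs.symm.y_le_of_odd (hvq.trans h1) hv.odd
        change (T.y q - T.y v) * (T.x e.guard - T.x v) ≤
          (T.y e.guard - T.y v) * (T.x q - T.x v) at h2
        nlinarith
    · exact ⟨e, he, hs⟩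
  have hdel : ∀ st : List (StackEntry n), (∀ e ∈ st, T.Reflex e.guard ∧ T.x q ≤ T.x e.guard ∧
      T.y q ≤ T.y e.guard) → ∀ v, T.LeftConvex v → v.val < q.val → T.Covered st v →
      T.Covered (T.deleteExceptRightmost st fun e => T.Sees e.guard q) v := by
    intro st hst v hv hvk hc
    refine hc.deleteExceptRightmost (fun e he => (hst e he).1) ?_
    intro e he g hg hPe hPg hx hs
    have hvq : T.x v < T.x q := T.x_lt_of_odd hvk hv.odd
    rcases (hst e he).2.1.eq_or_lt with h1 | h1
    · rw [← Reflex.eq_of_x_eq (Or.inr hq) (hst e he).1 h1] at hs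
      exact hs.concat hPg hv hq (hst g hg).1 hvq (hst g hg).2.1 (hst g hg).2.2
    · exact hs.cross hPg hvq h1 hx
  have hgood : ∀ e ∈ rest, T.Reflex e.guard ∧ T.x q ≤ T.x e.guard ∧ T.y q ≤ T.y e.guard :=
    fun e he => ⟨(hrest.entry e he).reflex, hxq e (hmem' e he), hyrest e he⟩
  have hfirst := firstSet_handleRightReflex (T := T) q s
  rcases hcase with ⟨hex, heq⟩ | ⟨u, st, p, hu, hup, huy, heq⟩
  · simp only [OrthogonalTerrain.handleRightReflex, heq] at hfirst ⊢
    refine ⟨hadv.sublist (deleteExceptRightmost_sublist _ _), fun e he =>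
      h.nonempty e (hmem' e ((deleteExceptRightmost_sublist _ _).subset he)), ?_⟩
    intro v f w hv hvk hf hw h1 h2
    change v.val < q.val at hvk
    left
    refine hdel rest hgood v hv hvk (hcov v hv hvk ?_)
    rcases h.covered v f w hv (hvk.trans (by omega)) hf hw h1 h2 with
      h3 | ⟨h3, h4, h5, e, st, hst', hL, -, hy⟩
    · exact h3
    · obtain rfl : w = q := Fin.ext (by omega)
      exact absurd ⟨e, st, f, hst', hL, hy⟩ hex
  · simp only [OrthogonalTerrain.handleRightReflex, heq] at hfirst ⊢
    have hus : u ∈ s.stack := by rw [hu]; exact List.mem_cons_self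
    have hxu : T.x q < T.x u.guard := by
      refine lt_of_le_of_ne (hxq u hus) fun h1 => ?_
      rw [← Reflex.eq_of_x_eq (Or.inr hq) (hst.entry u hus).reflex h1] at huy
      exact lt_irrefl _ huy
    have hxur : ∀ f ∈ rest, T.x u.guard < T.x f.guard := by
      intro f hf
      have hp := hst.pair
      have hf' := hmem' f hf
      rw [hu] at hp hf'
      rcases List.mem_cons.1 hf' with rfl | hf'
      · exact absurd huy (not_lt.2 (hyrest f hf))
      · exact ((List.pairwise_cons.1 hp).1 f hf').x_lt
    have hstack : T.StackInv q.val (T.deleteExceptRightmost (⟨q, pred q⟩ :: rest)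
        fun e => T.Sees e.guard q) := by
      -- If a remaining guard sees `q`, the new entry is deleted at once, since `q` also sees
      -- itself. Otherwise `q` is strictly below all remaining rays, as `PairInv` needs.
      by_cases hex : ∃ f ∈ rest, T.Sees f.guard q
      · obtain ⟨f, hf, hfs⟩ := hex
        refine hadv.sublist ?_
        classical
        rw [deleteExceptRightmost, List.filter_cons_of_neg]
        · exact List.filter_sublist
        · rw [decide_eq_true_eq, not_not]
          exact ⟨fun z hz => by
            rw [segment_same, Set.mem_singleton_iff] at hz
            rw [hz]; exact T.not_strictlyBelow_vertex q,
            f, List.mem_cons_of_mem _ hf, hfs, hxu.trans (hxur f hf)⟩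
      · refine (hadv.cons (hq.entryInv hpos) fun f hf => ?_).sublist
          (deleteExceptRightmost_sublist _ _)
        have hx := hxu.trans (hxur f hf)
        refine ⟨hx, hyrest f hf, ?_, fun h' => ?_⟩
        · by_contra h1
          exact hex ⟨f, hf, (hrest.entry f hf).sees_of_depth (Or.inr hq) le_rfl hx (hyrest f hf)
            (not_le.1 h1).le⟩
        · simp only [pred] at h'
          omega
    refine ⟨hstack, fun e he => ?_, ?_⟩
    · change e ∈ T.deleteExceptRightmost _ _ at he
      rcases List.mem_cons.1 ((deleteExceptRightmost_sublist _ _).subset he) with rfl | he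
      · simp [appendTo]
      · refine appendTo_ne_nil ?_
        -- The emptied list belongs to `u`, which is strictly left of all remaining guards.
        rw [Function.update_of_ne]
        · exact h.nonempty e (hmem' e he)
        · intro h1
          exact absurd (hxur e he) (by rw [h1]; exact lt_irrefl _)
    · intro v f w hv hvk hf hw h1 h2
      change v.val < q.val at hvk
      left
      refine hdel (⟨q, pred q⟩ :: rest) (fun e he => ?_) v hv hvk ?_
      · rcases List.mem_cons.1 he with rfl | he
        · exact ⟨Or.inr hq, le_rfl, le_rfl⟩
        · exact hgood e he
      · rcases h.covered v f w hv (hvk.trans (by omega)) (hfirst hf) hw h1 h2 with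
          h3 | ⟨h3, h4, h5, -⟩
        · obtain ⟨e, he, hs⟩ := hcov v hv hvk h3
          exact ⟨e, List.mem_cons_of_mem _ he, hs⟩
        · obtain rfl : w = q := Fin.ext (by omega)
          -- The transient case ends here: the witness `w` is the vertex just pushed.
          exact ⟨_, List.mem_cons_self, h1⟩

/-- Independence is kept to the end, the stack invariant only while vertices remain: after vertex
`0` the pushed obstacle is a dummy, as `pred` fixes that vertex. -/
theorem Step.invariant {s s' : SweepState n} (hs : T.Step s s')
    (h : T.Independent (firstSet s.list) ∧ (0 < s.unswept → T.SweepInv s)) :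
    T.Independent (firstSet s'.list) ∧ (0 < s'.unswept → T.SweepInv s') := by
  obtain ⟨hi, h⟩ := h
  cases hs with
  | leftConvex q r hn hq hr =>
    have h' := h (by rw [hn.1]; omega)
    exact ⟨h'.independent_handleLeftConvex hi hn.1 hq hr,
      fun _ => h'.handleLeftConvex hn.1 hq hr⟩
  | rightConvex q hn hq =>
    exact ⟨hi, fun _ => (h (by rw [hn.1]; omega)).handleRightConvex hn.1 hq⟩
  | leftReflex q hn hq =>
    have hlist : (T.handleLeftReflex q s).list = s.list := by
      unfold OrthogonalTerrain.handleLeftReflex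
      dsimp only
      split <;> rfl
    rw [hlist]
    exact ⟨hi, fun _ => (h (by rw [hn.1]; omega)).handleLeftReflex hn.1 hq hn.2⟩
  | rightReflex q hn hq =>
    have hsub := firstSet_handleRightReflex (T := T) q s
    exact ⟨fun u v hu hv => hi u v (hsub hu) (hsub hv), fun hpos =>
      (h (by rw [hn.1]; omega)).handleRightReflex hn.1 hq hpos⟩
  | intersection z hz =>
    exact ⟨hi, fun hpos => (h hpos).handleIntersection hz⟩

theorem independent_initial (T : OrthogonalTerrain n) :
    T.Independent (firstSet (SweepState.initial n).list) ∧
      (0 < (SweepState.initial n).unswept → T.SweepInv (SweepState.initial n)) := by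
  have hF : ∀ f, f ∉ firstSet (SweepState.initial n).list := by
    rintro f ⟨g, hg, -⟩
    exact hg rfl
  exact ⟨fun u v hu => absurd hu (hF u), fun _ =>
    ⟨⟨fun e he => absurd he List.not_mem_nil, List.Pairwise.nil⟩,
      fun e he => absurd he List.not_mem_nil, fun v f w _ _ hf => absurd hf (hF f)⟩⟩

end OrthogonalTerrain

theorem mainTheorem3 {n : ℕ} (T : OrthogonalTerrain n) (L : Fin n → List (Fin n))
    (hL : T.IsFinalLists L) (u v : Fin n) (hu : u ∈ firstSet L) (hv : v ∈ firstSet L)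
    (huv : u ≠ v) : ¬ ∃ w : Fin n, T.Reflex w ∧ T.Sees w u ∧ T.Sees w v := by
  obtain ⟨st, hst⟩ := hL
  have key : ∀ s, Relation.ReflTransGen T.Step (SweepState.initial n) s →
      T.Independent (firstSet s.list) ∧ (0 < s.unswept → T.SweepInv s) := by
    intro s hs
    induction hs with
    | refl => exact T.independent_initial
    | tail _ h ih => exact h.invariant ih
  exact (key _ hst).1 u v hu hv huv

end
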